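/- **Theorem 6.1 (Convergence of Cyclic Osborne).** Let $K\in\mathbb{R}_{\ge 0}^{n\times n}$ ($n\ge 1$) be balanceable, i.e. there is $x\in\mathbb{R}^n$ such that $A=\mathrm{diag}(e^{x})K\,\mathrm{diag}(e^{-x})$ satisfies $r(A)=c(A)$, where $r(A)=A\mathbf 1$ and $c(A)=A^{T}\mathbf 1$; let $\varepsilon>0$. Let $m$ be the number of nonzero entries of $K$, let $\kappa=(\sum_{ij}K_{ij})/\min_{K_{ij}\ne 0}K_{ij}$, and let $d$ be the diameter of the directed graph $G_K$ on $\{1,\dots,n\}$ with edges $\{(i,j):K_{ij}>0\}$ ($d=\infty$ if $G_K$ is not strongly connected). A vector $x$ solves $\mathrm{ABAL}(K,\varepsilon)$ if $A=\mathrm{diag}(e^{x})K\,\mathrm{diag}(e^{-x})$ is $\varepsilon$-balanced, i.e. $\|r(A)-c(A)\|_1/\sum_{ij}A_{ij}\le\varepsilon$ (the zero matrix counts as $\varepsilon$-balanced). Cyclic Osborne starts at $x=\mathbf 0$ and, while $A=\mathrm{diag}(e^{x})K\,\mathrm{diag}(e^{-x})$ is not $\varepsilon$-balanced, performs the Osborne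 update $x_k\leftarrow x_k+\tfrac12(\log c_k(A)-\log r_k(A))$ for the next coordinate $k$ (no change if row and column $k$ of $K$ vanish); the coordinates are visited cyclically, in the order of a uniformly random permutation of $\{1,\dots,n\}$ that is drawn anew and independently for each cycle. It is implemented in exact real arithmetic from the list of the nonzero entries of $K$: a preprocessing step computes the row sums, the column sums, the total and the $\ell_1$ imbalance of $K$ and tests whether $K$ is $\varepsilon$-balanced; each iteration of the loop then updates one coordinate, adapts these stored quantities to the changed entries of $A$, and tests $\varepsilon$-balancedness; it skips a coordinate without off-diagonal nonzeros in its row and column, for which the update changes nothing. Each operation $+,-,\times,\div,\exp,\log,|\cdot|,\le$ on real numbers counts as one arithmetic operation. There is a universal constant $c>0$ such that, for all such $n,K,\varepsilon$, the preprocessing takes at most $c\,(m+n)$ arithmetic operations; almost surely the loop stops, and its output is the first iterate that solves $\mathrm{ABAL}(K,\varepsilon)$; and the number $T$ of arithmetic operations of the loop satisfies: * (Expectation guarantee.) $\displaystyle \mathbb{E}[T]\le c\,\frac{m\sqrt n}{\varepsilon}\Big(\frac1\varepsilon\wedge d\Big)\log\kappa .$ * (High probability guarantee.) For all $\delta\in(0,1/e]$,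 $\displaystyle \mathbb{P}\Big(T\le c\,\frac{m\sqrt n}{\varepsilon}\Big(\frac1\varepsilon\wedge d\Big)\log\kappa\,\log\frac1\delta\Big)\ge 1-\delta .$ (If $K=0$, then $\kappa$ is not defined; in this case $T=0$ and both bounds are read as $T\le 0$.) -/

import Mathlib

open Matrix MeasureTheory ProbabilityTheory
open scoped ENNReal

noncomputable section

namespace Osborne

/-! ## Matrix balancing -/

variable {n : ℕ}

/-- Row sums `r(A) = A 1`. -/
def rowSum (A : Matrix (Fin n) (Fin n) ℝ) (i : Fin n) : ℝ := ∑ j, A i j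

/-- Column sums `c(A) = Aᵀ 1`. -/
def colSum (A : Matrix (Fin n) (Fin n) ℝ) (j : Fin n) : ℝ := ∑ i, A i j

/-- The scaling `diag(e^x) K diag(e^{-x})`. -/
def scaling (K : Matrix (Fin n) (Fin n) ℝ) (x : Fin n → ℝ) : Matrix (Fin n) (Fin n) ℝ :=
  Matrix.diagonal (fun i => Real.exp (x i)) * K * Matrix.diagonal (fun j => Real.exp (-x j))

/-- `A` is balanced if its row sums equal its column sums. -/
def IsBalanced (A : Matrix (Fin n) (Fin n) ℝ) : Prop := rowSum A = colSum A

/-- `A` is `ε`-balanced: `‖r(A) - c(A)‖₁ / ∑ A_ij ≤ ε`. (The zero matrix is `ε`-balanced.) -/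
def IsApproxBalanced (ε : ℝ) (A : Matrix (Fin n) (Fin n) ℝ) : Prop :=
  (∑ k, |rowSum A k - colSum A k|) / (∑ i, ∑ j, A i j) ≤ ε

/-- `K` is balanceable if some diagonal scaling `diag(e^x) K diag(e^{-x})` is balanced. -/
def IsBalanceable (K : Matrix (Fin n) (Fin n) ℝ) : Prop :=
  ∃ x : Fin n → ℝ, IsBalanced (scaling K x)

/-- `x` solves the approximate matrix balancing problem with input `K` and accuracy `ε`. -/
def SolvesABAL (K : Matrix (Fin n) (Fin n) ℝ) (ε : ℝ) (x : Fin n → ℝ) : Prop :=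
  IsApproxBalanced ε (scaling K x)

/-! ## The parameters of the input -/

/-- The number `m` of nonzero entries of `K`. -/
def nnz (K : Matrix (Fin n) (Fin n) ℝ) : ℕ := {p : Fin n × Fin n | K p.1 p.2 ≠ 0}.ncard

/-- `K_min`, the smallest nonzero entry of `K` (a minimum over a finite set). -/
def minEntry (K : Matrix (Fin n) (Fin n) ℝ) : ℝ := sInf {a : ℝ | a ≠ 0 ∧ ∃ i j, K i j = a}

/-- The condition number `κ = (∑ K_ij) / K_min`. -/
def condNumber (K : Matrix (Fin n) (Fin n) ℝ) : ℝ := (∑ i, ∑ j, K i j) / minEntry K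

/-- There is a walk of length `l` from `u` to `v` in the directed graph `G_K` with vertex set
`Fin n` and edges `{(i, j) : K i j > 0}`. -/
def HasWalk (K : Matrix (Fin n) (Fin n) ℝ) (l : ℕ) (u v : Fin n) : Prop :=
  ∃ p : ℕ → Fin n, p 0 = u ∧ p l = v ∧ ∀ i < l, 0 < K (p i) (p (i + 1))

/-- Directed distance in `G_K` (`⊤` if `v` cannot be reached from `u`). -/
def dist (K : Matrix (Fin n) (Fin n) ℝ) (u v : Fin n) : ℕ∞ :=
  ⨅ l : {l : ℕ // HasWalk K l u v}, (l.1 : ℕ∞)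

/-- The diameter `d` of `G_K`; it is finite if and only if `G_K` is strongly connected. -/
def diam (K : Matrix (Fin n) (Fin n) ℝ) : ℕ∞ := ⨆ u, ⨆ v, dist K u v

/-- `1/ε ∧ d` as a real number, where `d` may be infinite (and then the value is `1/ε`). -/
def invMin (ε : ℝ) (d : ℕ∞) : ℝ := (min (ENNReal.ofReal (1 / ε)) (d : ℝ≥0∞)).toReal

/-- `(m √n / ε) (1/ε ∧ d) log κ`. -/
def runtimeBound (K : Matrix (Fin n) (Fin n) ℝ) (ε : ℝ) : ℝ :=
  (nnz K : ℝ) * Real.sqrt n / ε * invMin ε (diam K) * Real.log (condNumber K)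

/-! ## Osborne's algorithm -/

/-- An Osborne update on coordinate `k`:
`x_k ← x_k + (log c_k(A) - log r_k(A)) / 2`, where `A = diag(e^x) K diag(e^{-x})`.
(If row `k` and column `k` of `K` both vanish, `x` is unchanged.) -/
def update (K : Matrix (Fin n) (Fin n) ℝ) (x : Fin n → ℝ) (k : Fin n) : Fin n → ℝ :=
  Function.update x k
    (x k + (Real.log (colSum (scaling K x) k) - Real.log (rowSum (scaling K x) k)) / 2)

/-- The iterates `x⁽⁰⁾ = 0, x⁽¹⁾, x⁽²⁾, …` for the sequence `k` of update coordinates. -/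
def iterate (K : Matrix (Fin n) (Fin n) ℝ) (k : ℕ → Fin n) : ℕ → Fin n → ℝ
  | 0 => 0
  | t + 1 => update K (iterate K k t) (k t)

/-- The update coordinates of the cyclic variant: cycle `j = t / n` visits the coordinates in the
order `σ j 0, σ j 1, …, σ j (n - 1)`. -/
def cyclicCoord [NeZero n] (σ : ℕ → Equiv.Perm (Fin n)) (t : ℕ) : Fin n :=
  σ (t / n) (Fin.ofNat n t)

/-- `σ 0, σ 1, …` are independent uniformly random permutations. -/
structure IsRandomOrder {Ω : Type*} [MeasurableSpace Ω] (P : Measure Ω)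
    (σ : ℕ → Ω → Equiv.Perm (Fin n)) : Prop where
  measurable : ∀ j, @Measurable Ω (Equiv.Perm (Fin n)) _ ⊤ (σ j)
  uniform : ∀ j (π : Equiv.Perm (Fin n)), P {ω | σ j ω = π} = ((n.factorial : ℕ) : ℝ≥0∞)⁻¹
  indep : iIndepFun (m := fun _ : ℕ => (⊤ : MeasurableSpace (Equiv.Perm (Fin n)))) σ P

/-! ## Programs with exact real arithmetic that count their arithmetic operations

In the programs below, every operation on real numbers goes through one of the primitives `add`,
`sub`, …, `le`, each of which counts as one arithmetic operation. -/

/-- A result together with the number of arithmetic operations spent on it. -/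
structure Counted (α : Type) where
  val : α
  ops : ℕ

namespace Counted

instance : Monad Counted where
  pure a := ⟨a, 0⟩
  bind a f := ⟨(f a.val).val, a.ops + (f a.val).ops⟩

def add (a b : ℝ) : Counted ℝ := ⟨a + b, 1⟩
def sub (a b : ℝ) : Counted ℝ := ⟨a - b, 1⟩
def mul (a b : ℝ) : Counted ℝ := ⟨a * b, 1⟩
def div (a b : ℝ) : Counted ℝ := ⟨a / b, 1⟩
def exp (a : ℝ) : Counted ℝ := ⟨Real.exp a, 1⟩
def log (a : ℝ) : Counted ℝ := ⟨Real.log a, 1⟩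
def abs (a : ℝ) : Counted ℝ := ⟨|a|, 1⟩

open Classical in
/-- Comparison of two reals. -/
def le (a b : ℝ) : Counted Bool := ⟨decide (a ≤ b), 1⟩

end Counted

open Classical in
/-- The positions of the nonzero entries of `K`, the sparse form in which `K` is given. -/
def entries (K : Matrix (Fin n) (Fin n) ℝ) : List (Fin n × Fin n) :=
  (List.finRange n ×ˢ List.finRange n).filter fun p => decide (K p.1 p.2 ≠ 0)

open Classical in
/-- The positions of the nonzero off-diagonal entries in row `k`. -/
def rowNbrs (K : Matrix (Fin n) (Fin n) ℝ) (k : Fin n) : List (Fin n) :=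
  (List.finRange n).filter fun j => decide (j ≠ k ∧ K k j ≠ 0)

open Classical in
/-- The positions of the nonzero off-diagonal entries in column `k`. -/
def colNbrs (K : Matrix (Fin n) (Fin n) ℝ) (k : Fin n) : List (Fin n) :=
  (List.finRange n).filter fun i => decide (i ≠ k ∧ K i k ≠ 0)

/-- The memory of the program. With `A = diag(e^x) K diag(e^{-x})`, it stores the current `x`, the
row and column sums of `A`, the number `imb = ‖r(A) - c(A)‖₁`, the number `tot = ∑ A_ij`, and
whether `A` is `ε`-balanced. -/
structure State (n : ℕ) where
  x : Fin n → ℝ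
  r : Fin n → ℝ
  c : Fin n → ℝ
  imb : ℝ
  tot : ℝ
  done : Bool

/-- The stopping test `imb ≤ ε * tot`. -/
def test (ε : ℝ) (s : State n) : Counted (State n) := do
  let thr ← Counted.mul ε s.tot
  let b ← Counted.le s.imb thr
  return { s with done := b }

/-- Preprocessing: initialize `x` to `0`, so that `A = K`, compute the stored quantities from the
nonzero entries of `K`, and test whether `K` is `ε`-balanced. -/
def init (K : Matrix (Fin n) (Fin n) ℝ) (ε : ℝ) : Counted (State n) := do
  let s₀ : State n := ⟨0, 0, 0, 0, 0, false⟩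
  let s₁ ← (entries K).foldlM (init := s₀) fun (s : State n) (p : Fin n × Fin n) => do
    let a ← Counted.add (s.r p.1) (K p.1 p.2)
    let b ← Counted.add (s.c p.2) (K p.1 p.2)
    let t ← Counted.add s.tot (K p.1 p.2)
    return { s with r := Function.update s.r p.1 a, c := Function.update s.c p.2 b, tot := t }
  let s₂ ← (List.finRange n).foldlM (init := s₁) fun (s : State n) (k : Fin n) => do
    let g ← Counted.sub (s.r k) (s.c k)
    let g ← Counted.abs g
    let v ← Counted.add s.imb g
    return { s with imb := v }
  test ε s₂

/-- Adapt the stored row sums, column sums, imbalance and total to a change of the off-diagonal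
entry `A i j` by `Δ`. Only `r i` and `c j` change, so only `|r i - c i|` and `|r j - c j|` have to
be replaced in the imbalance. -/
def changeEntry (s : State n) (i j : Fin n) (Δ : ℝ) : Counted (State n) := do
  let ri ← Counted.add (s.r i) Δ
  let cj ← Counted.add (s.c j) Δ
  let t ← Counted.add s.tot Δ
  let oldi ← Counted.sub (s.r i) (s.c i)
  let oldi ← Counted.abs oldi
  let oldj ← Counted.sub (s.r j) (s.c j)
  let oldj ← Counted.abs oldj
  let newi ← Counted.sub ri (s.c i)
  let newi ← Counted.abs newi
  let newj ← Counted.sub (s.r j) cj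
  let newj ← Counted.abs newj
  let v ← Counted.sub s.imb oldi
  let v ← Counted.sub v oldj
  let v ← Counted.add v newi
  let v ← Counted.add v newj
  return { s with r := Function.update s.r i ri, c := Function.update s.c j cj, imb := v, tot := t }

/-- `e^{a - b} * w`. -/
def scaledEntry (a b w : ℝ) : Counted ℝ := do
  let u ← Counted.sub a b
  let u ← Counted.exp u
  Counted.mul u w

/-- One iteration of the loop: the Osborne update on coordinate `k`, during which the stored
quantities are adapted to the changed entries of row `k` and column `k`, and then the stopping
test. A coordinate without off-diagonal nonzeros is skipped, since its update changes nothing. -/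
def step (K : Matrix (Fin n) (Fin n) ℝ) (ε : ℝ) (k : Fin n) (s : State n) :
    Counted (State n) :=
  if (rowNbrs K k).isEmpty && (colNbrs K k).isEmpty then pure s else do
    let lc ← Counted.log (s.c k)
    let lr ← Counted.log (s.r k)
    let δ ← Counted.sub lc lr
    let δ ← Counted.div δ 2
    let y ← Counted.add (s.x k) δ
    let s₁ ← (rowNbrs K k).foldlM (init := s) fun (s : State n) (j : Fin n) => do
      let old ← scaledEntry (s.x k) (s.x j) (K k j)
      let new ← scaledEntry y (s.x j) (K k j)
      let Δ ← Counted.sub new old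
      changeEntry s k j Δ
    let s₂ ← (colNbrs K k).foldlM (init := s₁) fun (s : State n) (i : Fin n) => do
      let old ← scaledEntry (s.x i) (s.x k) (K i k)
      let new ← scaledEntry (s.x i) y (K i k)
      let Δ ← Counted.sub new old
      changeEntry s i k Δ
    test ε { s₂ with x := Function.update s₂.x k y }

/-- The main loop, cut off after at most `N` iterations. It starts from the preprocessed memory,
stops as soon as the memory says that the current scaling is `ε`-balanced, and otherwise updates
the next coordinate. Its count does not contain the operations of the preprocessing. -/
def loop (K : Matrix (Fin n) (Fin n) ℝ) (ε : ℝ) (k : ℕ → Fin n) : ℕ → Counted (State n)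
  | 0 => pure (init K ε).val
  | t + 1 => do
    let s ← loop K ε k t
    if s.done then return s else step K ε (k t) s

/-- `T`: the number of arithmetic operations that the main loop spends until it stops. -/
def loopOps (K : Matrix (Fin n) (Fin n) ℝ) (ε : ℝ) (k : ℕ → Fin n) : ℕ∞ :=
  ⨆ N : ℕ, ((loop K ε k N).ops : ℕ∞)

end Osborne

end

/-!
Although the order of the coordinates is random, the bounds hold for every order: a cycle makes
enough progress as soon as it visits each coordinate exactly once, so that the expectation and the
probability are those of a quantity that is bounded everywhere. The factor `√n` is not needed.

Let `S(x)` be the sum of the entries of `diag(e^x) K diag(e^{-x})`. Its logarithm is convex, its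
gradient is `(r - c) / S`, and it is minimal at a balanced scaling. An update of coordinate `k`
lowers `S` by at least `a²` with `a = |√r_k - √c_k|`, and moves the row and column sums of the
other coordinates by at most `a b` in total, with `b = √r_k + √c_k` (`update_progress`).

Now consider a full cycle, in which `S` drops by `D`. Let `V` be the sum of all `a b`, and `M` the
sum of `r_k + c_k`, each taken when `k` is updated. Since every coordinate is updated once, the
drift of the sums before their update gives `M ≤ 2 S + V`, and the imbalance at the start of the
cycle is at most `2 V`. By Cauchy-Schwarz, `V² ≤ 2 D M`. Together, `imbalance² ≤ 48 D S`
(`cycle_progress`): the gap `g = log S - min log S` drops by at least `q² / 48` in a cycle that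
starts with the relative imbalance `q = imbalance / S`.

Initially `g ≤ log κ` (`minEntry_le_total`), so at most `48 log κ / ε²` cycles start with `q > ε`.
If the diameter `d` is finite, then along a path each edge costs at most `log κ` in `x`, so that
`x` oscillates by at most `d log κ`; with convexity this yields `g ≤ 2 q d log κ`
(`gap_le_imbalance`). A gap with this property drops so fast while it is large that only
`O(d log κ / ε)` cycles start with `q > ε` (`mul_le_of_quadratic_decrease`).

On the side of the program, the stored quantities are those of the current scaling
(`loop_correct`), and an iteration costs at most `29` operations per off-diagonal nonzero in the
updated row and column (`step_ops_le`), hence a cycle costs at most `58 m`.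
-/

noncomputable section

namespace Osborne

variable {n : ℕ}

/-! ### Scalings and their row and column sums -/

/-- The sum of all entries of `A`. -/
def total (A : Matrix (Fin n) (Fin n) ℝ) : ℝ := ∑ i, ∑ j, A i j

/-- The `ℓ₁` imbalance `‖r(A) - c(A)‖₁`. -/
def imbalance (A : Matrix (Fin n) (Fin n) ℝ) : ℝ := ∑ k, |rowSum A k - colSum A k|

lemma scaling_apply (K : Matrix (Fin n) (Fin n) ℝ) (x : Fin n → ℝ) (i j : Fin n) :
    scaling K x i j = Real.exp (x i - x j) * K i j := by
  simp only [scaling, Matrix.mul_diagonal, Matrix.diagonal_mul, sub_eq_add_neg, Real.exp_add]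
  ring

lemma scaling_zero (K : Matrix (Fin n) (Fin n) ℝ) : scaling K 0 = K := by
  ext i j
  simp [scaling_apply]

lemma scaling_nonneg {K : Matrix (Fin n) (Fin n) ℝ} (hK : ∀ i j, 0 ≤ K i j) (x : Fin n → ℝ)
    (i j : Fin n) : 0 ≤ scaling K x i j := by
  rw [scaling_apply]
  exact mul_nonneg (Real.exp_pos _).le (hK i j)

lemma sum_rowSum (A : Matrix (Fin n) (Fin n) ℝ) : ∑ k, rowSum A k = total A := rfl

lemma sum_colSum (A : Matrix (Fin n) (Fin n) ℝ) : ∑ k, colSum A k = total A :=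
  Finset.sum_comm

lemma total_nonneg {A : Matrix (Fin n) (Fin n) ℝ} (hA : ∀ i j, 0 ≤ A i j) : 0 ≤ total A :=
  Finset.sum_nonneg fun i _ => Finset.sum_nonneg fun j _ => hA i j

lemma rowSum_nonneg {A : Matrix (Fin n) (Fin n) ℝ} (hA : ∀ i j, 0 ≤ A i j) (k : Fin n) :
    0 ≤ rowSum A k :=
  Finset.sum_nonneg fun j _ => hA k j

lemma colSum_nonneg {A : Matrix (Fin n) (Fin n) ℝ} (hA : ∀ i j, 0 ≤ A i j) (k : Fin n) :
    0 ≤ colSum A k :=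
  Finset.sum_nonneg fun i _ => hA i k

lemma imbalance_nonneg (A : Matrix (Fin n) (Fin n) ℝ) : 0 ≤ imbalance A :=
  Finset.sum_nonneg fun _ _ => abs_nonneg _

lemma entry_le_total {A : Matrix (Fin n) (Fin n) ℝ} (hA : ∀ i j, 0 ≤ A i j) (i j : Fin n) :
    A i j ≤ total A :=
  (Finset.single_le_sum (f := fun j => A i j) (fun j _ => hA i j) (Finset.mem_univ j)).trans
    (Finset.single_le_sum (f := fun i => ∑ j, A i j)
      (fun i _ => Finset.sum_nonneg fun j _ => hA i j) (Finset.mem_univ i))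

lemma rowSum_scaling_eq_zero_iff {K : Matrix (Fin n) (Fin n) ℝ} (hK : ∀ i j, 0 ≤ K i j)
    (x : Fin n → ℝ) (k : Fin n) : rowSum (scaling K x) k = 0 ↔ ∀ j, K k j = 0 := by
  rw [rowSum, Finset.sum_eq_zero_iff_of_nonneg fun j _ => scaling_nonneg hK x k j]
  simp [scaling_apply]

lemma colSum_scaling_eq_zero_iff {K : Matrix (Fin n) (Fin n) ℝ} (hK : ∀ i j, 0 ≤ K i j)
    (x : Fin n → ℝ) (k : Fin n) : colSum (scaling K x) k = 0 ↔ ∀ i, K i k = 0 := by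
  rw [colSum, Finset.sum_eq_zero_iff_of_nonneg fun j _ => scaling_nonneg hK x j k]
  simp [scaling_apply]

lemma IsBalanceable.row_zero_iff {K : Matrix (Fin n) (Fin n) ℝ} (hK : ∀ i j, 0 ≤ K i j)
    (hb : IsBalanceable K) (k : Fin n) : (∀ j, K k j = 0) ↔ ∀ i, K i k = 0 := by
  obtain ⟨x, hx⟩ := hb
  rw [← rowSum_scaling_eq_zero_iff hK x, ← colSum_scaling_eq_zero_iff hK x, congrFun hx k]

lemma total_scaling_pos {K : Matrix (Fin n) (Fin n) ℝ} (hK : ∀ i j, 0 ≤ K i j) (h0 : K ≠ 0)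
    (x : Fin n → ℝ) : 0 < total (scaling K x) := by
  obtain ⟨i, j, hij⟩ : ∃ i j, K i j ≠ 0 := by
    by_contra! h
    exact h0 (Matrix.ext h)
  refine lt_of_lt_of_le ?_ (entry_le_total (scaling_nonneg hK x) i j)
  rw [scaling_apply]
  exact mul_pos (Real.exp_pos _) ((hK i j).lt_of_ne' hij)

/-- For a matrix with nonnegative entries, the quotient in the definition of approximate balance
may be cleared, because a vanishing total forces a vanishing imbalance. -/
lemma isApproxBalanced_iff {A : Matrix (Fin n) (Fin n) ℝ} (hA : ∀ i j, 0 ≤ A i j) {ε : ℝ}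
    (hε : 0 < ε) : IsApproxBalanced ε A ↔ imbalance A ≤ ε * total A := by
  change imbalance A / total A ≤ ε ↔ _
  rcases (total_nonneg hA).eq_or_lt with h | h
  · have hz : ∀ i j, A i j = 0 := fun i j =>
      le_antisymm ((entry_le_total hA i j).trans h.ge) (hA i j)
    have hI : imbalance A = 0 := by simp [imbalance, rowSum, colSum, hz]
    simp [← h, hI, hε.le]
  · rw [div_le_iff₀ h]

/-! ### A single Osborne update -/

/-- An update of coordinate `k` multiplies row `k` by `ρ = √(c_k / r_k)` and divides column `k`
by `ρ`. If row and column `k` vanish, then `ρ = 1`. -/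
lemma exists_update_factor {K : Matrix (Fin n) (Fin n) ℝ} (hK : ∀ i j, 0 ≤ K i j)
    (hb : IsBalanceable K) (x : Fin n → ℝ) (k : Fin n) :
    ∃ ρ : ℝ, 0 < ρ ∧ √(rowSum (scaling K x) k) * ρ = √(colSum (scaling K x) k) ∧
      ∀ i j, scaling K (update K x k) i j =
        (if i = k then ρ else 1) * (if j = k then ρ⁻¹ else 1) * scaling K x i j := by
  set r := rowSum (scaling K x) k with hr
  set c := colSum (scaling K x) k with hc
  refine ⟨Real.exp ((Real.log c - Real.log r) / 2), Real.exp_pos _, ?_, ?_⟩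
  · have hiff : r = 0 ↔ c = 0 := by
      rw [hr, hc, rowSum_scaling_eq_zero_iff hK, colSum_scaling_eq_zero_iff hK,
        hb.row_zero_iff hK]
    by_cases h : r = 0
    · simp [h, hiff.1 h]
    · have hr0 : 0 < r := (rowSum_nonneg (scaling_nonneg hK x) k).lt_of_ne' h
      have hc0 : 0 < c :=
        (colSum_nonneg (scaling_nonneg hK x) k).lt_of_ne' fun h' => h (hiff.2 h')
      have e1 : √r = Real.exp (Real.log r / 2) := by rw [Real.exp_half, Real.exp_log hr0]
      have e2 : √c = Real.exp (Real.log c / 2) := by rw [Real.exp_half, Real.exp_log hc0]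
      rw [e1, e2, ← Real.exp_add]
      ring_nf
  · intro i j
    simp only [scaling_apply, update, ← hr, ← hc, Function.update_apply, ← Real.exp_neg]
    split_ifs with h1 h2 h2
    · subst h1 h2
      rw [← Real.exp_add]
      simp
    · subst h1
      rw [mul_one, ← mul_assoc, ← Real.exp_add]
      ring_nf
    · subst h2
      rw [one_mul, ← mul_assoc, ← Real.exp_add]
      ring_nf
    · ring

/-- What one update does: the total drops by at least `(√r_k - √c_k)²`, and the row and column
sums of the other coordinates move by at most `|√r_k - √c_k| (√r_k + √c_k)` altogether. -/
lemma update_progress {K : Matrix (Fin n) (Fin n) ℝ} (hK : ∀ i j, 0 ≤ K i j)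
    (hb : IsBalanceable K) (x : Fin n → ℝ) (k : Fin n) :
    total (scaling K (update K x k)) ≤ total (scaling K x) -
        |√(rowSum (scaling K x) k) - √(colSum (scaling K x) k)| ^ 2 ∧
      ∑ i, (if i = k then 0 else
        |rowSum (scaling K (update K x k)) i - rowSum (scaling K x) i| +
          |colSum (scaling K (update K x k)) i - colSum (scaling K x) i|) ≤
        |√(rowSum (scaling K x) k) - √(colSum (scaling K x) k)| *
          (√(rowSum (scaling K x) k) + √(colSum (scaling K x) k)) := by
  obtain ⟨ρ, hρ, hpq, hA⟩ := exists_update_factor hK hb x k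
  set A := scaling K x with hAdef
  set B := scaling K (update K x k) with hBdef
  have hA0 : ∀ i j, 0 ≤ A i j := scaling_nonneg hK x
  set p := √(rowSum A k) with hp
  set q := √(colSum A k) with hq
  have hp0 : 0 ≤ p := Real.sqrt_nonneg _
  have hq0 : 0 ≤ q := Real.sqrt_nonneg _
  have hr : rowSum A k = p ^ 2 := (Real.sq_sqrt (rowSum_nonneg hA0 k)).symm
  have hc : colSum A k = q ^ 2 := (Real.sq_sqrt (colSum_nonneg hA0 k)).symm
  have hqp : q * ρ⁻¹ = p := by rw [← hpq]; field_simp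
  have hrow : ∀ i, i ≠ k → rowSum B i - rowSum A i = (ρ⁻¹ - 1) * A i k := by
    intro i hi
    rw [rowSum, rowSum, ← Finset.sum_sub_distrib, Finset.sum_eq_single k]
    · simp only [hA, if_neg hi, if_true]; ring
    · intro j _ hj
      simp [hA, hi, hj]
    · simp
  have hcol : ∀ j, j ≠ k → colSum B j - colSum A j = (ρ - 1) * A k j := by
    intro j hj
    rw [colSum, colSum, ← Finset.sum_sub_distrib, Finset.sum_eq_single k]
    · simp only [hA, if_neg hj, if_true]; ring
    · intro i _ hi
      simp [hA, hi, hj]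
    · simp
  have hrk : rowSum B k - rowSum A k = (ρ - 1) * (p ^ 2 - A k k) := by
    rw [← hr, rowSum, rowSum, ← Finset.sum_sub_distrib,
      ← Finset.add_sum_erase _ _ (Finset.mem_univ k),
      ← Finset.add_sum_erase Finset.univ (fun j => A k j) (Finset.mem_univ k),
      add_sub_cancel_left, Finset.mul_sum]
    have h1 : B k k - A k k = 0 := by simp [hA, hρ.ne']
    rw [h1, zero_add]
    refine Finset.sum_congr rfl fun j hj => ?_
    simp only [hA, if_neg (Finset.ne_of_mem_erase hj), if_true]
    ring
  have hsumc : ∑ i ∈ Finset.univ.erase k, A i k = q ^ 2 - A k k := by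
    rw [← hc, colSum, ← Finset.add_sum_erase _ _ (Finset.mem_univ k)]
    ring
  have hsumr : ∑ j ∈ Finset.univ.erase k, A k j = p ^ 2 - A k k := by
    rw [← hr, rowSum, ← Finset.add_sum_erase _ _ (Finset.mem_univ k)]
    ring
  constructor
  · have hdiff : total B - total A =
        (ρ - 1) * (p ^ 2 - A k k) + (ρ⁻¹ - 1) * (q ^ 2 - A k k) := by
      rw [← sum_rowSum, ← sum_rowSum, ← Finset.sum_sub_distrib,
        ← Finset.add_sum_erase _ _ (Finset.mem_univ k), hrk, ← hsumc, Finset.mul_sum]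
      congr 1
      exact Finset.sum_congr rfl fun i hi => hrow i (Finset.ne_of_mem_erase hi)
    have e1 : ρ * p ^ 2 = p * q := by rw [← hpq]; ring
    have e2 : ρ⁻¹ * q ^ 2 = p * q := by rw [← hqp]; ring
    have h2 : 0 ≤ (ρ + ρ⁻¹ - 2) * A k k := by
      refine mul_nonneg ?_ (hA0 k k)
      have : ρ + ρ⁻¹ - 2 = (ρ - 1) ^ 2 / ρ := by field_simp; ring
      rw [this]
      positivity
    rw [sq_abs]
    nlinarith
  · have hsplit : ∑ i, (if i = k then 0 else
        |rowSum B i - rowSum A i| + |colSum B i - colSum A i|) =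
        |ρ⁻¹ - 1| * (q ^ 2 - A k k) + |ρ - 1| * (p ^ 2 - A k k) := by
      rw [← Finset.add_sum_erase _ _ (Finset.mem_univ k), if_pos rfl, zero_add, ← hsumc,
        ← hsumr, Finset.mul_sum, Finset.mul_sum, ← Finset.sum_add_distrib]
      refine Finset.sum_congr rfl fun i hi => ?_
      have hi' := Finset.ne_of_mem_erase hi
      rw [if_neg hi', hrow i hi', hcol i hi', abs_mul, abs_mul, abs_of_nonneg (hA0 i k),
        abs_of_nonneg (hA0 k i)]
    rw [hsplit]
    have e1 : |ρ⁻¹ - 1| * q ^ 2 = |p - q| * q := by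
      rw [← hqp, sq, ← mul_assoc]
      congr 1
      rw [← abs_of_nonneg hq0, ← abs_mul, abs_of_nonneg hq0]
      ring_nf
    have e2 : |ρ - 1| * p ^ 2 = |p - q| * p := by
      rw [abs_sub_comm p q, ← hpq, sq, ← mul_assoc]
      congr 1
      rw [← abs_of_nonneg hp0, ← abs_mul, abs_of_nonneg hp0]
      ring_nf
    have h3 := mul_nonneg (abs_nonneg (ρ⁻¹ - 1)) (hA0 k k)
    have h4 := mul_nonneg (abs_nonneg (ρ - 1)) (hA0 k k)
    nlinarith

/-! ### Log-convexity of the total -/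

lemma sum_rowSum_sub_colSum_mul (A : Matrix (Fin n) (Fin n) ℝ) (z : Fin n → ℝ) :
    ∑ k, (rowSum A k - colSum A k) * z k = ∑ i, ∑ j, A i j * (z i - z j) := by
  simp only [sub_mul, mul_sub, Finset.sum_sub_distrib, rowSum, colSum, Finset.sum_mul]
  congr 1
  exact Finset.sum_comm

/-- The gradient inequality for the convex function `x ↦ log (total (scaling K x))`. -/
lemma log_total_gradient_le {K : Matrix (Fin n) (Fin n) ℝ} (hK : ∀ i j, 0 ≤ K i j) (h0 : K ≠ 0)
    (x y : Fin n → ℝ) :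
    Real.log (total (scaling K x)) - Real.log (total (scaling K y)) ≤
      (∑ k, (rowSum (scaling K x) k - colSum (scaling K x) k) * (x k - y k)) /
        total (scaling K x) := by
  set S := total (scaling K x) with hS
  have hSpos : 0 < S := total_scaling_pos hK h0 x
  set z : Fin n → ℝ := fun k => y k - x k with hz
  set G := ∑ k, (rowSum (scaling K x) k - colSum (scaling K x) k) * z k with hG
  have hneg : ∑ k, (rowSum (scaling K x) k - colSum (scaling K x) k) * (x k - y k) = -G := by
    rw [hG, ← Finset.sum_neg_distrib]
    exact Finset.sum_congr rfl fun k _ => by rw [hz]; ring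
  have key : Real.exp (G / S) * S ≤ total (scaling K y) := by
    have h1 : ∀ i j, Real.exp (G / S) * (scaling K x i j + scaling K x i j * (z i - z j) -
        scaling K x i j * (G / S)) ≤ scaling K y i j := by
      intro i j
      have e : scaling K y i j =
          Real.exp (G / S) * (scaling K x i j * Real.exp (z i - z j - G / S)) := by
        rw [scaling_apply, scaling_apply]
        have : y i - y j = G / S + ((x i - x j) + (z i - z j - G / S)) := by
          simp only [hz]; ring
        rw [this, Real.exp_add, Real.exp_add]
        ring
      rw [e]
      refine mul_le_mul_of_nonneg_left ?_ (Real.exp_pos _).le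
      have := mul_le_mul_of_nonneg_left (Real.add_one_le_exp (z i - z j - G / S))
        (scaling_nonneg hK x i j)
      linarith
    calc Real.exp (G / S) * S = Real.exp (G / S) * (S + G - S * (G / S)) := by
          rw [mul_div_cancel₀ _ hSpos.ne']; ring
      _ = ∑ i, ∑ j, Real.exp (G / S) * (scaling K x i j + scaling K x i j * (z i - z j) -
            scaling K x i j * (G / S)) := by
          rw [hG, sum_rowSum_sub_colSum_mul]
          simp only [← Finset.mul_sum, Finset.sum_sub_distrib, Finset.sum_add_distrib,
            ← Finset.sum_mul]
          rfl
      _ ≤ total (scaling K y) :=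
          Finset.sum_le_sum fun i _ => Finset.sum_le_sum fun j _ => h1 i j
  have := Real.log_le_log (by positivity) key
  rw [Real.log_mul (Real.exp_pos _).ne' hSpos.ne', Real.log_exp] at this
  rw [hneg, neg_div]
  linarith

/-- A balanced scaling minimizes the total. -/
lemma log_total_le_of_isBalanced {K : Matrix (Fin n) (Fin n) ℝ} (hK : ∀ i j, 0 ≤ K i j)
    (h0 : K ≠ 0) {x : Fin n → ℝ} (hx : IsBalanced (scaling K x)) (y : Fin n → ℝ) :
    Real.log (total (scaling K x)) ≤ Real.log (total (scaling K y)) := by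
  have h := log_total_gradient_le hK h0 x y
  have hz : ∀ k, rowSum (scaling K x) k - colSum (scaling K x) k = 0 := fun k =>
    sub_eq_zero.2 (congrFun hx k)
  simp only [hz, zero_mul, Finset.sum_const_zero, zero_div] at h
  linarith

/-! ### The condition number and the diameter -/

lemma minEntry_le {K : Matrix (Fin n) (Fin n) ℝ} (hK : ∀ i j, 0 ≤ K i j) {i j : Fin n}
    (h : K i j ≠ 0) : minEntry K ≤ K i j :=
  csInf_le ⟨0, fun _ ⟨_, i, j, ha⟩ => ha ▸ hK i j⟩ ⟨h, i, j, rfl⟩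

lemma minEntry_pos {K : Matrix (Fin n) (Fin n) ℝ} (hK : ∀ i j, 0 ≤ K i j) (h0 : K ≠ 0) :
    0 < minEntry K := by
  obtain ⟨i, j, hij⟩ : ∃ i j, K i j ≠ 0 := by
    by_contra! h
    exact h0 (Matrix.ext h)
  have hfin : {a : ℝ | a ≠ 0 ∧ ∃ i j, K i j = a}.Finite := by
    refine (Set.finite_range fun p : Fin n × Fin n => K p.1 p.2).subset ?_
    rintro a ⟨-, i, j, rfl⟩
    exact ⟨(i, j), rfl⟩
  have hmem : minEntry K ∈ {a : ℝ | a ≠ 0 ∧ ∃ i j, K i j = a} :=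
    Set.Nonempty.csInf_mem ⟨K i j, hij, i, j, rfl⟩ hfin
  obtain ⟨h, i', j', h'⟩ := hmem
  exact (h'.symm ▸ hK i' j' : 0 ≤ minEntry K).lt_of_ne' h

/-- Every scaling of a nonzero balanceable matrix has total at least the smallest nonzero entry
of the matrix. Otherwise, in a balanced scaling `diag(e^x) K diag(e^{-x})`, every edge would
strictly increase `x`; but the endpoint of an edge has, by balance, an outgoing edge. -/
lemma minEntry_le_total {K : Matrix (Fin n) (Fin n) ℝ} (hK : ∀ i j, 0 ≤ K i j) (h0 : K ≠ 0)
    {x : Fin n → ℝ} (hx : IsBalanced (scaling K x)) : minEntry K ≤ total (scaling K x) := by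
  by_contra! hlt
  have hinc : ∀ i j, K i j ≠ 0 → x i < x j := by
    intro i j hij
    by_contra! hle
    have h1 : K i j ≤ scaling K x i j := by
      rw [scaling_apply]
      exact le_mul_of_one_le_left (hK i j) (Real.one_le_exp (sub_nonneg.2 hle))
    linarith [entry_le_total (scaling_nonneg hK x) i j, minEntry_le hK hij]
  have hne : ∃ j i, K i j ≠ 0 := by
    by_contra! h
    exact h0 (Matrix.ext fun i j => h j i)
  classical
  obtain ⟨j, hj, hmax⟩ := Finset.exists_max_image
    (Finset.univ.filter fun j => ∃ i, K i j ≠ 0) x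
    (by obtain ⟨j, h⟩ := hne; exact ⟨j, by simpa using h⟩)
  have hrow : ∃ l, K j l ≠ 0 := by
    by_contra! h
    obtain ⟨i, hi⟩ := (Finset.mem_filter.1 hj).2
    exact hi ((IsBalanceable.row_zero_iff hK ⟨x, hx⟩ j).1 h i)
  obtain ⟨l, hl⟩ := hrow
  exact (hinc j l hl).not_ge (hmax l (Finset.mem_filter.2 ⟨Finset.mem_univ _, j, hl⟩))

lemma log_total_sub_log_minEntry {K : Matrix (Fin n) (Fin n) ℝ} (hK : ∀ i j, 0 ≤ K i j)
    (h0 : K ≠ 0) : Real.log (total K) - Real.log (minEntry K) = Real.log (condNumber K) := by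
  have h := total_scaling_pos hK h0 0
  rw [scaling_zero] at h
  exact (Real.log_div h.ne' (minEntry_pos hK h0).ne').symm

lemma log_condNumber_nonneg {K : Matrix (Fin n) (Fin n) ℝ} (hK : ∀ i j, 0 ≤ K i j) :
    0 ≤ Real.log (condNumber K) := by
  by_cases h0 : K = 0
  · subst h0
    simp [condNumber]
  obtain ⟨i, j, hij⟩ : ∃ i j, K i j ≠ 0 := by
    by_contra! h
    exact h0 (Matrix.ext h)
  refine Real.log_nonneg ?_
  rw [condNumber, one_le_div (minEntry_pos hK h0)]
  exact (minEntry_le hK hij).trans (entry_le_total hK i j)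

/-- As long as the total does not exceed its initial value, every entry of the scaling is at most
`total K`, so that `x` drops by at most `log κ` along an edge. -/
lemma sub_le_of_hasWalk {K : Matrix (Fin n) (Fin n) ℝ} (hK : ∀ i j, 0 ≤ K i j) (h0 : K ≠ 0)
    {x : Fin n → ℝ} (hx : total (scaling K x) ≤ total K) {l : ℕ} {u v : Fin n}
    (h : HasWalk K l u v) : x u - x v ≤ l * Real.log (condNumber K) := by
  obtain ⟨p, rfl, rfl, hp⟩ := h
  have hstep : ∀ i < l, x (p i) - x (p (i + 1)) ≤ Real.log (condNumber K) := by
    intro i hi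
    have hpos := hp i hi
    have hm := minEntry_le hK hpos.ne'
    have hm0 := minEntry_pos hK h0
    have h1 := (entry_le_total (scaling_nonneg hK x) (p i) (p (i + 1))).trans hx
    rw [scaling_apply] at h1
    have h2 := Real.log_le_log (by positivity) h1
    rw [Real.log_mul (Real.exp_pos _).ne' hpos.ne', Real.log_exp] at h2
    have h3 := Real.log_le_log hm0 hm
    rw [← log_total_sub_log_minEntry hK h0]
    linarith
  have : ∀ i ≤ l, x (p 0) - x (p i) ≤ i * Real.log (condNumber K) := by
    intro i
    induction i with
    | zero => simp
    | succ i ih =>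
      intro hi
      have := hstep i (by omega)
      have := ih (by omega)
      push_cast
      linarith
  exact this l le_rfl

lemma sub_le_of_diam {K : Matrix (Fin n) (Fin n) ℝ} (hK : ∀ i j, 0 ≤ K i j) (h0 : K ≠ 0)
    {x : Fin n → ℝ} (hx : total (scaling K x) ≤ total K) {d : ℕ} (hd : diam K = d)
    (u v : Fin n) : x u - x v ≤ d * Real.log (condNumber K) := by
  have h1 : dist K u v ≤ d := hd ▸ (le_iSup_of_le u (le_iSup (dist K u) v))
  have hne : Nonempty {l : ℕ // HasWalk K l u v} := by
    by_contra h
    rw [not_nonempty_iff] at h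
    rw [dist, iInf_of_empty] at h1
    exact (WithTop.coe_ne_top (top_le_iff.1 h1)).elim
  obtain ⟨⟨l, hl⟩, hle⟩ := ciInf_mem fun l : {l : ℕ // HasWalk K l u v} => (l.1 : ℕ∞)
  have hld : l ≤ d := by
    rw [dist, ← hle] at h1
    exact Nat.cast_le.1 h1
  refine (sub_le_of_hasWalk hK h0 hx hl).trans ?_
  exact mul_le_mul_of_nonneg_right (by exact_mod_cast hld) (log_condNumber_nonneg hK)

/-- The optimality gap is controlled by the relative imbalance: by convexity it is at most the
product of the imbalance and the oscillation of the difference to an optimal point. -/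
lemma gap_le_imbalance {K : Matrix (Fin n) (Fin n) ℝ} (hK : ∀ i j, 0 ≤ K i j) (h0 : K ≠ 0)
    {x y : Fin n → ℝ} (hx : total (scaling K x) ≤ total K) (hy : total (scaling K y) ≤ total K)
    {d : ℕ} (hd : diam K = d) :
    Real.log (total (scaling K x)) - Real.log (total (scaling K y)) ≤
      imbalance (scaling K x) / total (scaling K x) * (2 * d * Real.log (condNumber K)) := by
  refine (log_total_gradient_le hK h0 x y).trans ?_
  rw [div_mul_eq_mul_div]
  refine div_le_div_of_nonneg_right ?_ (total_scaling_pos hK h0 x).le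
  obtain ⟨v⟩ : Nonempty (Fin n) := by
    by_contra h
    rw [not_nonempty_iff] at h
    exact h0 (Subsingleton.elim _ _)
  have hshift : ∑ k, (rowSum (scaling K x) k - colSum (scaling K x) k) * (x k - y k) =
      ∑ k, (rowSum (scaling K x) k - colSum (scaling K x) k) *
        ((x k - y k) - (x v - y v)) := by
    simp only [mul_sub _ (x _ - y _), Finset.sum_sub_distrib, ← Finset.sum_mul, sum_rowSum,
      sum_colSum]
    ring
  rw [hshift, imbalance, Finset.sum_mul]
  refine Finset.sum_le_sum fun k _ => ?_
  refine (le_abs_self _).trans ?_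
  rw [abs_mul]
  refine mul_le_mul_of_nonneg_left ?_ (abs_nonneg _)
  rw [abs_le]
  constructor <;>
  linarith [sub_le_of_diam hK h0 hx hd k v, sub_le_of_diam hK h0 hx hd v k,
    sub_le_of_diam hK h0 hy hd k v, sub_le_of_diam hK h0 hy hd v k]

/-! ### A full cycle -/

lemma sum_range_eq_sum_univ {e : ℕ → Fin n} (he : Set.InjOn e (Finset.range n))
    (f : Fin n → ℝ) : ∑ t ∈ Finset.range n, f (e t) = ∑ k, f k := by
  rw [← Finset.sum_image (f := f) he]
  congr 1
  exact Finset.eq_univ_of_card _ (by rw [Finset.card_image_of_injOn he]; simp)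

/-- A cycle that visits every coordinate exactly once, in whatever order, lowers the total `S` by
at least `imbalance² / (48 S)`. -/
theorem cycle_progress {K : Matrix (Fin n) (Fin n) ℝ} (hK : ∀ i j, 0 ≤ K i j)
    (hb : IsBalanceable K) {e : ℕ → Fin n} (he : Set.InjOn e (Finset.range n))
    {y : ℕ → Fin n → ℝ} (hy : ∀ t < n, y (t + 1) = update K (y t) (e t)) :
    imbalance (scaling K (y 0)) ^ 2 ≤
      48 * (total (scaling K (y 0)) - total (scaling K (y n))) * total (scaling K (y 0)) := by
  set r : ℕ → Fin n → ℝ := fun t => rowSum (scaling K (y t)) with hr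
  set c : ℕ → Fin n → ℝ := fun t => colSum (scaling K (y t)) with hc
  set a : ℕ → ℝ := fun t => |√(r t (e t)) - √(c t (e t))| with ha
  set b : ℕ → ℝ := fun t => √(r t (e t)) + √(c t (e t)) with hbd
  -- the change of the row and column sum of `k` at time `s`, unless `k` itself is updated
  set w : ℕ → Fin n → ℝ := fun s k => if k = e s then 0 else
    |r (s + 1) k - r s k| + |c (s + 1) k - c s k| with hw
  set S := total (scaling K (y 0)) with hS
  set D := S - total (scaling K (y n)) with hD
  set M := ∑ t ∈ Finset.range n, (r t (e t) + c t (e t)) with hM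
  set V := ∑ t ∈ Finset.range n, a t * b t with hV
  have hr0 : ∀ t k, 0 ≤ r t k := fun t k => rowSum_nonneg (scaling_nonneg hK _) k
  have hc0 : ∀ t k, 0 ≤ c t k := fun t k => colSum_nonneg (scaling_nonneg hK _) k
  have hw0 : ∀ s k, 0 ≤ w s k := by
    intro s k
    simp only [hw]
    split_ifs <;> positivity
  have hprog : ∀ t < n, total (scaling K (y (t + 1))) ≤ total (scaling K (y t)) - a t ^ 2 := by
    intro t ht
    rw [hy t ht]
    exact (update_progress hK hb (y t) (e t)).1
  have hwab : ∀ t < n, ∑ k, w t k ≤ a t * b t := by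
    intro t ht
    simp only [hw, hr, hc, hy t ht]
    exact (update_progress hK hb (y t) (e t)).2
  have hDa : ∑ t ∈ Finset.range n, a t ^ 2 ≤ D := by
    have : ∀ m ≤ n, ∑ t ∈ Finset.range m, a t ^ 2 ≤ S - total (scaling K (y m)) := by
      intro m
      induction m with
      | zero => simp [hS]
      | succ m ih =>
        intro hm
        rw [Finset.sum_range_succ]
        linarith [ih (by omega), hprog m (by omega)]
    exact this n le_rfl
  have hb2 : ∑ t ∈ Finset.range n, b t ^ 2 ≤ 2 * M := by
    rw [hM, Finset.mul_sum]
    refine Finset.sum_le_sum fun t _ => ?_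
    have h1 := Real.sq_sqrt (hr0 t (e t))
    have h2 := Real.sq_sqrt (hc0 t (e t))
    simp only [hbd]
    nlinarith [sq_nonneg (√(r t (e t)) - √(c t (e t)))]
  have hCS : V ^ 2 ≤ D * (2 * M) :=
    (Finset.sum_mul_sq_le_sq_mul_sq _ _ _).trans
      (mul_le_mul hDa hb2 (Finset.sum_nonneg fun _ _ => sq_nonneg _)
        ((Finset.sum_nonneg fun _ _ => sq_nonneg _).trans hDa))
  -- until its own update, a coordinate is moved only by the updates of the others
  have hdrift : ∀ t < n, |r t (e t) - r 0 (e t)| + |c t (e t) - c 0 (e t)| ≤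
      ∑ s ∈ Finset.range n, w s (e t) := by
    intro t ht
    have : ∀ m ≤ t, |r m (e t) - r 0 (e t)| + |c m (e t) - c 0 (e t)| ≤
        ∑ s ∈ Finset.range m, w s (e t) := by
      intro m
      induction m with
      | zero => simp
      | succ m ih =>
        intro hm
        have hne : e t ≠ e m := fun h => by
          have := he (by simpa using ht) (by simp; omega) h
          omega
        have h1 := ih (by omega)
        have h2 : w m (e t) = |r (m + 1) (e t) - r m (e t)| + |c (m + 1) (e t) - c m (e t)| := by
          simp only [hw, if_neg hne]
        rw [Finset.sum_range_succ, h2]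
        linarith [abs_sub_le (r (m + 1) (e t)) (r m (e t)) (r 0 (e t)),
          abs_sub_le (c (m + 1) (e t)) (c m (e t)) (c 0 (e t))]
    exact (this t le_rfl).trans (Finset.sum_le_sum_of_subset_of_nonneg
      (Finset.range_mono ht.le) fun s _ _ => hw0 s _)
  have hdriftV : ∑ t ∈ Finset.range n, (|r t (e t) - r 0 (e t)| + |c t (e t) - c 0 (e t)|) ≤ V := by
    calc _ ≤ ∑ t ∈ Finset.range n, ∑ s ∈ Finset.range n, w s (e t) :=
          Finset.sum_le_sum fun t ht => hdrift t (Finset.mem_range.1 ht)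
      _ = ∑ s ∈ Finset.range n, ∑ k, w s k := by
          rw [Finset.sum_comm]
          exact Finset.sum_congr rfl fun s _ => sum_range_eq_sum_univ he (w s)
      _ ≤ V := Finset.sum_le_sum fun s hs => hwab s (Finset.mem_range.1 hs)
  have hMle : M ≤ 2 * S + V := by
    have h1 : ∑ t ∈ Finset.range n, (r 0 (e t) + c 0 (e t)) = 2 * S := by
      rw [sum_range_eq_sum_univ he fun k => r 0 k + c 0 k, Finset.sum_add_distrib, two_mul]
      exact congrArg₂ _ (sum_rowSum _) (sum_colSum _)
    rw [← h1]
    refine le_trans ?_ (add_le_add_right hdriftV _)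
    rw [← Finset.sum_add_distrib]
    refine Finset.sum_le_sum fun t _ => ?_
    linarith [le_abs_self (r t (e t) - r 0 (e t)), le_abs_self (c t (e t) - c 0 (e t))]
  have hI : imbalance (scaling K (y 0)) ≤ 2 * V := by
    have h1 : imbalance (scaling K (y 0)) = ∑ t ∈ Finset.range n, |r 0 (e t) - c 0 (e t)| :=
      (sum_range_eq_sum_univ he fun k => |r 0 k - c 0 k|).symm
    have h2 : ∀ t, |r t (e t) - c t (e t)| = a t * b t := by
      intro t
      have hb' : b t = |b t| := (abs_of_nonneg (by positivity)).symm
      rw [hb', ← abs_mul]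
      congr 1
      simp only [hbd]
      nlinarith [Real.sq_sqrt (hr0 t (e t)), Real.sq_sqrt (hc0 t (e t))]
    rw [h1, two_mul]
    refine le_trans ?_ (add_le_add_right hdriftV _)
    rw [hV, ← Finset.sum_add_distrib]
    refine Finset.sum_le_sum fun t _ => ?_
    rw [← h2]
    have h3 := abs_sub_le (r 0 (e t)) (r t (e t)) (c 0 (e t))
    have h4 := abs_sub_le (r t (e t)) (c t (e t)) (c 0 (e t))
    rw [abs_sub_comm (r 0 (e t)) (r t (e t))] at h3
    linarith
  have hD0 : 0 ≤ D := (Finset.sum_nonneg fun _ _ => sq_nonneg _).trans hDa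
  have hDS : D ≤ S := by linarith [total_nonneg (scaling_nonneg hK (y n))]
  have hV0 : 0 ≤ V := Finset.sum_nonneg fun t _ => by positivity
  have hV1 : V ^ 2 ≤ 2 * D * (2 * S + V) := by nlinarith
  have hV2 : V ≤ 4 * S := by
    by_contra! h
    nlinarith [mul_le_mul_of_nonneg_right hDS (by linarith : 0 ≤ 2 * S + V)]
  have hV3 : V ^ 2 ≤ 12 * D * S := by nlinarith
  nlinarith [imbalance_nonneg (scaling K (y 0))]

/-! ### The number of cycles -/

/-- A gap `g` that drops by `q² / 48` in each step, with `q ≥ ε` and `q ≥ g / R`, can do so for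
at most `192 R / ε` steps: since `2 q ≥ h` for `h = ε + g / R`, the reciprocal `1 / h` grows by at
least `1 / (192 R)` in each step, and it cannot exceed `1 / ε`. -/
lemma mul_le_of_quadratic_decrease {g q : ℕ → ℝ} {R ε : ℝ} {N : ℕ} (hε : 0 < ε) (hR : 0 ≤ R)
    (hg : ∀ j, 0 ≤ g j) (hq : ∀ j < N, ε < q j) (hstep : ∀ j < N, g (j + 1) ≤ g j - q j ^ 2 / 48)
    (hgap : ∀ j < N, g j ≤ q j * R) : N * ε ≤ 192 * R := by
  rcases Nat.eq_zero_or_pos N with rfl | hN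
  · simpa using hR
  have hRpos : 0 < R := by
    refine hR.lt_of_ne' fun h => ?_
    have h1 := hgap 0 hN
    have h2 := hstep 0 hN
    have h3 := hg 1
    have h4 := hq 0 hN
    rw [h, mul_zero] at h1
    rw [zero_add] at h2
    nlinarith
  set h : ℕ → ℝ := fun j => ε + g j / R with hh
  set c := 1 / (192 * R) with hc
  have hcpos : 0 < c := by positivity
  have hhε : ∀ j, ε ≤ h j := fun j => le_add_of_nonneg_right (div_nonneg (hg j) hR)
  have hdec : ∀ j < N, h (j + 1) ≤ h j - c * h j ^ 2 := by
    intro j hj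
    have h1 : g j / R ≤ q j := (div_le_iff₀ hRpos).2 (hgap j hj)
    have h2 : h j ≤ 2 * q j := by simp only [hh]; linarith [hq j hj]
    have h3 : h j ^ 2 ≤ 4 * q j ^ 2 := by nlinarith [hhε j]
    have h4 : g (j + 1) / R ≤ (g j - q j ^ 2 / 48) / R :=
      div_le_div_of_nonneg_right (hstep j hj) hR
    have h5 : (g j - q j ^ 2 / 48) / R = g j / R - c * (4 * q j ^ 2) := by
      rw [hc]; field_simp; ring
    have h6 := mul_le_mul_of_nonneg_left h3 hcpos.le
    have e1 : h (j + 1) = ε + g (j + 1) / R := rfl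
    have e2 : h j = ε + g j / R := rfl
    linarith
  have hinv : ∀ j ≤ N, j * c * h j ≤ 1 := by
    intro j
    induction j with
    | zero => simp
    | succ j ih =>
      intro hj
      have h1 := ih (by omega)
      have h2 := hdec j (by omega)
      have h3 : 0 < h j := hε.trans_le (hhε j)
      have h4 : 0 < h (j + 1) := hε.trans_le (hhε _)
      have h5 : c * h j ≤ 1 := by
        by_contra! hlt
        nlinarith
      have h6 : 0 ≤ ((j : ℝ) + 1) * c := by positivity
      have h7 := mul_le_mul_of_nonneg_left h2 h6
      have h8 : 0 ≤ (1 - j * c * h j) * (1 - c * h j) :=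
        mul_nonneg (by linarith) (by linarith)
      push_cast
      nlinarith [sq_nonneg (c * h j)]
  have h1 := hinv N le_rfl
  have h2 : N * c * ε ≤ 1 :=
    (mul_le_mul_of_nonneg_left (hhε N) (by positivity)).trans h1
  have h3 : N * c * ε = N * ε / (192 * R) := by rw [hc]; ring
  rwa [h3, div_le_one (by positivity)] at h2

lemma mul_le_of_linear_decrease {g q : ℕ → ℝ} {ε : ℝ} {N : ℕ} (hε : 0 < ε)
    (hg : ∀ j, 0 ≤ g j) (hq : ∀ j < N, ε < q j)
    (hstep : ∀ j < N, g (j + 1) ≤ g j - q j ^ 2 / 48) : N * ε ^ 2 ≤ 48 * g 0 := by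
  have : ∀ j ≤ N, j * ε ^ 2 ≤ 48 * (g 0 - g j) := by
    intro j
    induction j with
    | zero => simp
    | succ j ih =>
      intro hj
      have h1 := ih (by omega)
      have h2 := hstep j (by omega)
      have h3 : ε ^ 2 ≤ q j ^ 2 := pow_le_pow_left₀ hε.le (hq j (by omega)).le 2
      push_cast
      linarith
  linarith [this N le_rfl, hg N]

lemma invMin_top {ε : ℝ} (hε : 0 < ε) : invMin ε ⊤ = 1 / ε := by
  simp [invMin, hε.le]

lemma invMin_natCast {ε : ℝ} (hε : 0 < ε) (d : ℕ) : invMin ε d = min (1 / ε) d := by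
  have h : ((d : ℕ∞) : ℝ≥0∞) = ENNReal.ofReal (d : ℝ) := by simp
  rw [invMin, h, ← ENNReal.ofReal_min, ENNReal.toReal_ofReal (by positivity)]

lemma invMin_nonneg (ε : ℝ) (d : ℕ∞) : 0 ≤ invMin ε d := ENNReal.toReal_nonneg

/-- If each cycle makes the progress of `cycle_progress`, then at most
`(384 / ε) (1/ε ∧ d) log κ` cycles can start from a scaling that is not `ε`-balanced. -/
theorem cycles_le {K : Matrix (Fin n) (Fin n) ℝ} (hK : ∀ i j, 0 ≤ K i j)
    (hb : IsBalanceable K) {ε : ℝ} (hε : 0 < ε) {z : ℕ → Fin n → ℝ} (hz0 : z 0 = 0)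
    (hz : ∀ j, imbalance (scaling K (z j)) ^ 2 ≤
      48 * (total (scaling K (z j)) - total (scaling K (z (j + 1)))) * total (scaling K (z j)))
    {N : ℕ} (hN : ∀ j < N, ¬ SolvesABAL K ε (z j)) :
    (N : ℝ) ≤ 384 * (invMin ε (diam K) * Real.log (condNumber K)) / ε := by
  have hκ := log_condNumber_nonneg hK
  rcases Nat.eq_zero_or_pos N with rfl | hNpos
  · have := invMin_nonneg ε (diam K)
    simp only [CharP.cast_eq_zero]
    positivity
  have hun : ∀ j < N, ε * total (scaling K (z j)) < imbalance (scaling K (z j)) := by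
    intro j hj
    have := hN j hj
    rwa [SolvesABAL, isApproxBalanced_iff (scaling_nonneg hK _) hε, not_le] at this
  have h0 : K ≠ 0 := by
    rintro rfl
    have := hun 0 hNpos
    simp [total, imbalance, rowSum, colSum, scaling_apply] at this
  set T : ℕ → ℝ := fun j => total (scaling K (z j)) with hT
  have hTpos : ∀ j, 0 < T j := fun j => total_scaling_pos hK h0 _
  set q : ℕ → ℝ := fun j => imbalance (scaling K (z j)) / T j with hq
  have hTq : ∀ j, T (j + 1) / T j ≤ 1 - q j ^ 2 / 48 := by
    intro j
    have h1 := hz j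
    have e : q j ^ 2 / 48 = imbalance (scaling K (z j)) ^ 2 / (48 * T j * T j) := by
      have := (hTpos j).ne'
      simp only [hq]
      field_simp
    have h2 : imbalance (scaling K (z j)) ^ 2 / (48 * T j * T j) ≤ (T j - T (j + 1)) / T j := by
      have := hTpos j
      rw [div_le_div_iff₀ (by positivity) this]
      have h3 := mul_le_mul_of_nonneg_right h1 this.le
      calc _ ≤ _ := h3
        _ = _ := by ring
    rw [sub_div, div_self (hTpos j).ne'] at h2
    linarith
  have hTle : ∀ j, T j ≤ total K := by
    intro j
    induction j with
    | zero => simp [hT, hz0, scaling_zero]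
    | succ j ih =>
      have h1 : T (j + 1) / T j ≤ 1 := (hTq j).trans (by linarith [sq_nonneg (q j)])
      exact ((div_le_one (hTpos j)).1 h1).trans ih
  obtain ⟨y, hy⟩ := hb
  have hyK : total (scaling K y) ≤ total K := by
    have h := log_total_le_of_isBalanced hK h0 hy 0
    rw [Real.log_le_log_iff (total_scaling_pos hK h0 _) (total_scaling_pos hK h0 _),
      scaling_zero] at h
    exact h
  set g : ℕ → ℝ := fun j => Real.log (T j) - Real.log (total (scaling K y)) with hgdef
  have hg0 : ∀ j, 0 ≤ g j := fun j => sub_nonneg.2 (log_total_le_of_isBalanced hK h0 hy _)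
  have hqε : ∀ j < N, ε < q j := fun j hj => (lt_div_iff₀ (hTpos j)).2 (hun j hj)
  have hstep : ∀ j < N, g (j + 1) ≤ g j - q j ^ 2 / 48 := by
    intro j _
    have h1 := Real.log_le_sub_one_of_pos (div_pos (hTpos (j + 1)) (hTpos j))
    rw [Real.log_div (hTpos _).ne' (hTpos _).ne'] at h1
    simp only [hgdef]
    linarith [hTq j]
  have hg0κ : g 0 ≤ Real.log (condNumber K) := by
    have h1 := Real.log_le_log (hTpos 0) (hTle 0)
    have h2 := Real.log_le_log (minEntry_pos hK h0) (minEntry_le_total hK h0 hy)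
    rw [← log_total_sub_log_minEntry hK h0]
    simp only [hgdef]
    linarith
  have hA : (N : ℝ) * ε ≤ 384 * (1 / ε * Real.log (condNumber K)) := by
    have h1 := mul_le_of_linear_decrease hε hg0 hqε hstep
    have h2 : (N : ℝ) * ε = N * ε ^ 2 / ε := by field_simp
    rw [h2, div_le_iff₀ hε]
    have h3 : 384 * (1 / ε * Real.log (condNumber K)) * ε = 384 * Real.log (condNumber K) := by
      field_simp
    rw [h3]
    linarith
  rw [le_div_iff₀ hε]
  rcases hd : diam K with _ | d
  · exact (invMin_top hε).symm ▸ hA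
  · change (N : ℝ) * ε ≤ 384 * (invMin ε (d : ℕ∞) * Real.log (condNumber K))
    have hB : (N : ℝ) * ε ≤ 384 * (d * Real.log (condNumber K)) := by
      have := mul_le_of_quadratic_decrease (R := 2 * d * Real.log (condNumber K)) hε
        (by positivity) hg0 hqε hstep
        fun j _ => gap_le_imbalance hK h0 (hTle j) hyK hd
      linarith
    rw [invMin_natCast hε]
    rcases min_choice (1 / ε) (d : ℝ) with h | h <;> rw [h] <;> assumption

/-! ### Counted programs -/

namespace Counted

lemma bind_val {α β : Type} (a : Counted α) (f : α → Counted β) :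
    (a >>= f).val = (f a.val).val := rfl

lemma bind_ops {α β : Type} (a : Counted α) (f : α → Counted β) :
    (a >>= f).ops = a.ops + (f a.val).ops := rfl

lemma foldlM_ops {α β : Type} (f : β → α → Counted β) {m : ℕ} (hf : ∀ s a, (f s a).ops = m)
    (l : List α) (s : β) : (l.foldlM f s).ops = m * l.length := by
  induction l generalizing s with
  | nil => rfl
  | cons a l ih =>
    rw [List.foldlM_cons, bind_ops, ih, hf, List.length_cons]
    ring

end Counted

/-! ### The stored quantities follow the matrix -/

/-- The quantities stored in `s` are those of the matrix `A`. -/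
structure Tracks (s : State n) (A : Matrix (Fin n) (Fin n) ℝ) : Prop where
  r : s.r = rowSum A
  c : s.c = colSum A
  imb : s.imb = imbalance A
  tot : s.tot = total A

lemma rowSum_add_single (A : Matrix (Fin n) (Fin n) ℝ) (i j : Fin n) (Δ : ℝ) :
    rowSum (A + Matrix.single i j Δ) = Function.update (rowSum A) i (rowSum A i + Δ) := by
  funext k
  rw [Function.update_apply]
  split_ifs with h
  · subst h
    simp [rowSum, Finset.sum_add_distrib, Matrix.single_apply]
  · simp [rowSum, Ne.symm h]

lemma colSum_add_single (A : Matrix (Fin n) (Fin n) ℝ) (i j : Fin n) (Δ : ℝ) :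
    colSum (A + Matrix.single i j Δ) = Function.update (colSum A) j (colSum A j + Δ) := by
  funext k
  rw [Function.update_apply]
  split_ifs with h
  · subst h
    simp [colSum, Finset.sum_add_distrib, Matrix.single_apply]
  · simp [colSum, Ne.symm h]

lemma total_add_single (A : Matrix (Fin n) (Fin n) ℝ) (i j : Fin n) (Δ : ℝ) :
    total (A + Matrix.single i j Δ) = total A + Δ := by
  rw [← sum_rowSum, rowSum_add_single, Finset.sum_update_of_mem (Finset.mem_univ i),
    ← sum_rowSum, ← Finset.add_sum_erase _ _ (Finset.mem_univ i), Finset.sdiff_singleton_eq_erase]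
  ring

lemma scaledEntry_ops (a b w : ℝ) : (scaledEntry a b w).ops = 3 := rfl

lemma changeEntry_ops (s : State n) (i j : Fin n) (Δ : ℝ) : (changeEntry s i j Δ).ops = 15 :=
  rfl

lemma changeEntry_x (s : State n) (i j : Fin n) (Δ : ℝ) : (changeEntry s i j Δ).val.x = s.x :=
  rfl

lemma Tracks.add_single {s : State n} {A : Matrix (Fin n) (Fin n) ℝ} (h : Tracks s A)
    {i j : Fin n} (hij : i ≠ j) (Δ : ℝ) :
    Tracks (changeEntry s i j Δ).val (A + Matrix.single i j Δ) := by
  refine ⟨?_, ?_, ?_, ?_⟩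
  · rw [rowSum_add_single, ← h.r]
    rfl
  · rw [colSum_add_single, ← h.c]
    rfl
  · change s.imb - |s.r i - s.c i| - |s.r j - s.c j| + |s.r i + Δ - s.c i| +
      |s.r j - (s.c j + Δ)| = _
    rw [h.r, h.c, h.imb, imbalance, imbalance, rowSum_add_single, colSum_add_single]
    have key : ∑ k, (|Function.update (rowSum A) i (rowSum A i + Δ) k -
        Function.update (colSum A) j (colSum A j + Δ) k| - |rowSum A k - colSum A k|) =
        (|rowSum A i + Δ - colSum A i| - |rowSum A i - colSum A i|) +
          (|rowSum A j - (colSum A j + Δ)| - |rowSum A j - colSum A j|) := by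
      rw [← Finset.sum_subset (Finset.subset_univ {i, j}), Finset.sum_pair hij]
      · simp [hij, hij.symm]
      · intro k _ hk
        simp only [Finset.mem_insert, Finset.mem_singleton, not_or] at hk
        simp [hk.1, hk.2]
    rw [Finset.sum_sub_distrib] at key
    linarith
  · rw [total_add_single, ← h.tot]
    rfl

lemma Tracks.foldlM {α : Type} {f : State n → α → Counted (State n)}
    {x : Fin n → ℝ} {pos : α → Fin n × Fin n} {Δ : α → ℝ}
    (hf : ∀ s a, s.x = x → (f s a).val = (changeEntry s (pos a).1 (pos a).2 (Δ a)).val)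
    {l : List α} (hl : ∀ a ∈ l, (pos a).1 ≠ (pos a).2) {s : State n} (hs : s.x = x)
    {A : Matrix (Fin n) (Fin n) ℝ} (h : Tracks s A) :
    (l.foldlM f s).val.x = x ∧
      Tracks (l.foldlM f s).val
        (A + (l.map fun a => Matrix.single (pos a).1 (pos a).2 (Δ a)).sum) := by
  induction l generalizing s A with
  | nil =>
    rw [List.map_nil, List.sum_nil, add_zero]
    exact ⟨hs, h⟩
  | cons a l ih =>
    rw [List.foldlM_cons, Counted.bind_val, hf s a hs, List.map_cons, List.sum_cons, ← add_assoc]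
    exact ih (fun b hb => hl b (List.mem_cons_of_mem _ hb)) ((changeEntry_x ..).trans hs)
      (h.add_single (hl a List.mem_cons_self) _)

lemma sum_map_filter_finRange {M : Type*} [AddCommMonoid M] (p : Fin n → Prop) [DecidablePred p]
    (f : Fin n → M) : (((List.finRange n).filter fun a => decide (p a)).map f).sum =
      ∑ a, if p a then f a else 0 := by
  rw [Fin.sum_univ_def]
  induction List.finRange n with
  | nil => rfl
  | cons a l ih =>
    by_cases h : p a <;> simp [h, ih]

lemma length_filter_finRange (p : Fin n → Prop) [DecidablePred p] :
    ((List.finRange n).filter fun a => decide (p a)).length = ∑ a, if p a then 1 else 0 := by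
  rw [← sum_map_filter_finRange]
  simp

open Classical in
lemma nnz_eq_sum (K : Matrix (Fin n) (Fin n) ℝ) :
    nnz K = ∑ i, ∑ j, if K i j ≠ 0 then 1 else 0 := by
  have h : {p : Fin n × Fin n | K p.1 p.2 ≠ 0} =
      ↑(Finset.univ.filter fun p : Fin n × Fin n => K p.1 p.2 ≠ 0) := by
    ext; simp
  rw [nnz, h, Set.ncard_coe_finset, Finset.card_filter, Fintype.sum_prod_type]

lemma mem_entries {K : Matrix (Fin n) (Fin n) ℝ} {p : Fin n × Fin n} :
    p ∈ entries K ↔ K p.1 p.2 ≠ 0 := by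
  have h : p ∈ List.finRange n ×ˢ List.finRange n :=
    List.pair_mem_product.2 ⟨List.mem_finRange _, List.mem_finRange _⟩
  rw [entries, List.mem_filter, decide_eq_true_iff]
  exact and_iff_right h

lemma length_entries (K : Matrix (Fin n) (Fin n) ℝ) : (entries K).length = nnz K := by
  classical
  have hnd : (entries K).Nodup :=
    ((List.nodup_finRange n).product (List.nodup_finRange n)).filter _
  have h : {p : Fin n × Fin n | K p.1 p.2 ≠ 0} = ↑(entries K).toFinset := by
    ext p
    simp [mem_entries]
  rw [nnz, h, Set.ncard_coe_finset, List.toFinset_card_of_nodup hnd]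

/-- The number of nonzero off-diagonal entries in row and column `k`. -/
def nbrCount (K : Matrix (Fin n) (Fin n) ℝ) (k : Fin n) : ℕ :=
  (rowNbrs K k).length + (colNbrs K k).length

lemma sum_nbrCount_le (K : Matrix (Fin n) (Fin n) ℝ) : ∑ k, nbrCount K k ≤ 2 * nnz K := by
  classical
  simp only [nbrCount, Finset.sum_add_distrib, two_mul]
  refine add_le_add ?_ ?_
  · rw [nnz_eq_sum]
    refine Finset.sum_le_sum fun k _ => ?_
    rw [rowNbrs, length_filter_finRange]
    refine Finset.sum_le_sum fun j _ => ?_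
    split_ifs <;> simp_all
  · rw [nnz_eq_sum, Finset.sum_comm]
    refine Finset.sum_le_sum fun k _ => ?_
    rw [colNbrs, length_filter_finRange]
    refine Finset.sum_le_sum fun j _ => ?_
    split_ifs <;> simp_all

/-- The memory `s` is correct: it stores the quantities of the current scaling, and `done` tells
whether the current scaling is `ε`-balanced. -/
structure Correct (K : Matrix (Fin n) (Fin n) ℝ) (ε : ℝ) (s : State n) : Prop where
  tracks : Tracks s (scaling K s.x)
  done_iff : s.done = true ↔ SolvesABAL K ε s.x

lemma Tracks.test {K : Matrix (Fin n) (Fin n) ℝ} (hK : ∀ i j, 0 ≤ K i j) {ε : ℝ} (hε : 0 < ε)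
    {s : State n} (h : Tracks s (scaling K s.x)) : Correct K ε (test ε s).val := by
  refine ⟨⟨h.r, h.c, h.imb, h.tot⟩, ?_⟩
  change decide (s.imb ≤ ε * s.tot) = true ↔ IsApproxBalanced ε (scaling K s.x)
  rw [decide_eq_true_iff, isApproxBalanced_iff (scaling_nonneg hK _) hε, h.imb, h.tot]

/-! ### Preprocessing -/

lemma init_ops (K : Matrix (Fin n) (Fin n) ℝ) (ε : ℝ) :
    (init K ε).ops = 3 * nnz K + (3 * n + 2) := by
  rw [init, Counted.bind_ops, Counted.bind_ops, Counted.foldlM_ops (m := 3) _ (fun _ _ => rfl),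
    Counted.foldlM_ops (m := 3) _ (fun _ _ => rfl), length_entries, List.length_finRange]
  rfl

lemma sum_single_entries (K : Matrix (Fin n) (Fin n) ℝ) :
    ((entries K).map fun p => Matrix.single p.1 p.2 (K p.1 p.2)).sum = K := by
  classical
  have hnd : (entries K).Nodup :=
    ((List.nodup_finRange n).product (List.nodup_finRange n)).filter _
  rw [← List.sum_toFinset _ hnd]
  conv_rhs => rw [Matrix.matrix_eq_sum_single K]
  rw [← Fintype.sum_prod_type' fun i j => Matrix.single i j (K i j)]
  refine Finset.sum_subset (Finset.subset_univ _) fun p _ hp => ?_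
  have : K p.1 p.2 = 0 := by simpa [mem_entries] using hp
  simp [this]

lemma init_correct {K : Matrix (Fin n) (Fin n) ℝ} (hK : ∀ i j, 0 ≤ K i j) {ε : ℝ}
    (hε : 0 < ε) : (init K ε).val.x = 0 ∧ Correct K ε (init K ε).val := by
  have h1 : ∀ (l : List (Fin n × Fin n)) (s : State n) (A : Matrix (Fin n) (Fin n) ℝ),
      s.x = 0 → s.imb = 0 → s.r = rowSum A → s.c = colSum A → s.tot = total A →
      let s' := (l.foldlM (init := s) fun (s : State n) (p : Fin n × Fin n) => do
        let a ← Counted.add (s.r p.1) (K p.1 p.2)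
        let b ← Counted.add (s.c p.2) (K p.1 p.2)
        let t ← Counted.add s.tot (K p.1 p.2)
        return { s with
          r := Function.update s.r p.1 a, c := Function.update s.c p.2 b, tot := t }).val
      let A' := A + (l.map fun p => Matrix.single p.1 p.2 (K p.1 p.2)).sum
      s'.x = 0 ∧ s'.imb = 0 ∧ s'.r = rowSum A' ∧ s'.c = colSum A' ∧ s'.tot = total A' := by
    intro l
    induction l with
    | nil =>
      intro s A hx hi hr hc ht
      rw [List.map_nil, List.sum_nil, add_zero]
      exact ⟨hx, hi, hr, hc, ht⟩
    | cons p l ih =>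
      intro s A hx hi hr hc ht
      simp only [List.foldlM_cons, Counted.bind_val, List.map_cons, List.sum_cons, ← add_assoc]
      refine ih _ (A + Matrix.single p.1 p.2 (K p.1 p.2)) hx hi ?_ ?_ ?_
      · rw [rowSum_add_single, ← hr]
        rfl
      · rw [colSum_add_single, ← hc]
        rfl
      · rw [total_add_single, ← ht]
        rfl
  have h2 : ∀ (l : List (Fin n)) (s : State n),
      let s' := (l.foldlM (init := s) fun (s : State n) (k : Fin n) => do
        let g ← Counted.sub (s.r k) (s.c k)
        let g ← Counted.abs g
        let v ← Counted.add s.imb g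
        return { s with imb := v }).val
      s'.x = s.x ∧ s'.imb = s.imb + (l.map fun k => |s.r k - s.c k|).sum ∧ s'.r = s.r ∧
        s'.c = s.c ∧ s'.tot = s.tot := by
    intro l
    induction l with
    | nil => intro s; exact ⟨rfl, by simp; rfl, rfl, rfl, rfl⟩
    | cons k l ih =>
      intro s
      simp only [List.foldlM_cons, Counted.bind_val, List.map_cons, List.sum_cons]
      obtain ⟨e1, e2, e3, e4, e5⟩ := ih ⟨s.x, s.r, s.c, s.imb + |s.r k - s.c k|, s.tot, s.done⟩
      exact ⟨e1, e2.trans (add_assoc _ _ _), e3, e4, e5⟩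
  obtain ⟨a1, a2, a3, a4, a5⟩ := h1 (entries K) ⟨0, 0, 0, 0, 0, false⟩ 0 rfl rfl
    (by funext; simp [rowSum]) (by funext; simp [colSum]) (by simp [total])
  rw [zero_add, sum_single_entries] at a3 a4 a5
  obtain ⟨b1, b2, b3, b4, b5⟩ := h2 (List.finRange n) _
  rw [a1] at b1
  rw [a2, a3, a4, zero_add, ← Fin.sum_univ_def] at b2
  rw [a3] at b3
  rw [a4] at b4
  rw [a5] at b5
  refine ⟨b1, Tracks.test hK hε ?_⟩
  rw [b1, scaling_zero]
  exact ⟨b3, b4, b2, b5⟩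

/-! ### One iteration -/

/-- Without off-diagonal nonzeros in row and column `k`, both sums equal the diagonal entry, and
the update does nothing. -/
lemma update_eq_self {K : Matrix (Fin n) (Fin n) ℝ} {k : Fin n} (hr : rowNbrs K k = [])
    (hc : colNbrs K k = []) (x : Fin n → ℝ) : update K x k = x := by
  have hr' : ∀ j, j ≠ k → K k j = 0 := by simpa [rowNbrs] using hr
  have hc' : ∀ i, i ≠ k → K i k = 0 := by simpa [colNbrs] using hc
  have h1 : rowSum (scaling K x) k = scaling K x k k :=
    Finset.sum_eq_single k (fun j _ hj => by simp [scaling_apply, hr' j hj]) (by simp)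
  have h2 : colSum (scaling K x) k = scaling K x k k :=
    Finset.sum_eq_single k (fun i _ hi => by simp [scaling_apply, hc' i hi]) (by simp)
  simp [update, h1, h2]

/-- Replacing `x k` by `y` changes only the off-diagonal nonzeros in row and column `k`. -/
lemma scaling_update_eq (K : Matrix (Fin n) (Fin n) ℝ) (x : Fin n → ℝ) (k : Fin n) (y : ℝ) :
    scaling K (Function.update x k y) = scaling K x +
      ((rowNbrs K k).map fun j => Matrix.single k j
        (Real.exp (y - x j) * K k j - Real.exp (x k - x j) * K k j)).sum +
      ((colNbrs K k).map fun i => Matrix.single i k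
        (Real.exp (x i - y) * K i k - Real.exp (x i - x k) * K i k)).sum := by
  classical
  rw [rowNbrs, colNbrs, sum_map_filter_finRange, sum_map_filter_finRange]
  ext i j
  have e1 : (∑ a, if a ≠ k ∧ K k a ≠ 0 then Matrix.single k a
      (Real.exp (y - x a) * K k a - Real.exp (x k - x a) * K k a) else 0) i j =
      if i = k ∧ j ≠ k then Real.exp (y - x j) * K k j - Real.exp (x k - x j) * K k j else 0 := by
    rw [Matrix.sum_apply, Finset.sum_eq_single j]
    · rcases eq_or_ne i k with rfl | h2
      · by_cases h0 : K i j = 0 <;> by_cases h1 : j = i <;> simp [h0, h1]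
      · rw [if_neg (show ¬ (i = k ∧ j ≠ k) from fun h => h2 h.1)]
        split_ifs <;> simp [h2.symm]
    · intro a _ ha
      split_ifs <;> simp [ha]
    · simp
  have e2 : (∑ a, if a ≠ k ∧ K a k ≠ 0 then Matrix.single a k
      (Real.exp (x a - y) * K a k - Real.exp (x a - x k) * K a k) else 0) i j =
      if j = k ∧ i ≠ k then Real.exp (x i - y) * K i k - Real.exp (x i - x k) * K i k else 0 := by
    rw [Matrix.sum_apply, Finset.sum_eq_single i]
    · rcases eq_or_ne j k with rfl | h2
      · by_cases h0 : K i j = 0 <;> by_cases h1 : i = j <;> simp [h0, h1]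
      · rw [if_neg (show ¬ (j = k ∧ i ≠ k) from fun h => h2 h.1)]
        split_ifs <;> simp [h2.symm]
    · intro a _ ha
      split_ifs <;> simp [ha]
    · simp
  rw [Matrix.add_apply, Matrix.add_apply, e1, e2]
  simp only [scaling_apply, Function.update_apply]
  by_cases h1 : i = k <;> by_cases h2 : j = k <;> simp [h1, h2]

/-- The part of an iteration that changes row `k` when `x k` becomes `y`. -/
def rowPass (K : Matrix (Fin n) (Fin n) ℝ) (k : Fin n) (y : ℝ) (s : State n) :
    Counted (State n) :=
  (rowNbrs K k).foldlM (init := s) fun (s : State n) (j : Fin n) => do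
    let old ← scaledEntry (s.x k) (s.x j) (K k j)
    let new ← scaledEntry y (s.x j) (K k j)
    let Δ ← Counted.sub new old
    changeEntry s k j Δ

/-- The part of an iteration that changes column `k` when `x k` becomes `y`. -/
def colPass (K : Matrix (Fin n) (Fin n) ℝ) (k : Fin n) (y : ℝ) (s : State n) :
    Counted (State n) :=
  (colNbrs K k).foldlM (init := s) fun (s : State n) (i : Fin n) => do
    let old ← scaledEntry (s.x i) (s.x k) (K i k)
    let new ← scaledEntry (s.x i) y (K i k)
    let Δ ← Counted.sub new old
    changeEntry s i k Δ

lemma rowPass_ops (K : Matrix (Fin n) (Fin n) ℝ) (k : Fin n) (y : ℝ) (s : State n) :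
    (rowPass K k y s).ops = 22 * (rowNbrs K k).length := by
  refine Counted.foldlM_ops (m := 22) _ (fun s a => ?_) _ _
  simp only [Counted.bind_ops, scaledEntry_ops, changeEntry_ops]
  rfl

lemma colPass_ops (K : Matrix (Fin n) (Fin n) ℝ) (k : Fin n) (y : ℝ) (s : State n) :
    (colPass K k y s).ops = 22 * (colNbrs K k).length := by
  refine Counted.foldlM_ops (m := 22) _ (fun s a => ?_) _ _
  simp only [Counted.bind_ops, scaledEntry_ops, changeEntry_ops]
  rfl

/-- The two passes leave `x` alone and adapt the stored quantities to the scaling in which `x k` is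
replaced by `y`. -/
lemma passes_spec {K A : Matrix (Fin n) (Fin n) ℝ} (k : Fin n) (y : ℝ) {s : State n}
    (hs : Tracks s (scaling K s.x)) (hA : A = scaling K (Function.update s.x k y)) :
    (colPass K k y (rowPass K k y s).val).val.x = s.x ∧
      Tracks (colPass K k y (rowPass K k y s).val).val A := by
  subst hA
  rw [scaling_update_eq]
  obtain ⟨x1, t1⟩ := Tracks.foldlM (x := s.x)
    (f := fun (s : State n) (j : Fin n) => do
      let old ← scaledEntry (s.x k) (s.x j) (K k j)
      let new ← scaledEntry y (s.x j) (K k j)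
      let Δ ← Counted.sub new old
      changeEntry s k j Δ)
    (pos := fun j => (k, j))
    (Δ := fun j => Real.exp (y - s.x j) * K k j - Real.exp (s.x k - s.x j) * K k j)
    (fun s' j hs' => by rw [← hs']; rfl) (l := rowNbrs K k)
    (fun j hj => by
      simp only [rowNbrs, List.mem_filter, decide_eq_true_eq] at hj
      exact hj.2.1.symm) rfl hs
  exact Tracks.foldlM (x := s.x) (pos := fun i => (i, k))
    (Δ := fun i => Real.exp (s.x i - y) * K i k - Real.exp (s.x i - s.x k) * K i k)
    (fun s' i hs' => by rw [← hs']; rfl) (l := colNbrs K k)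
    (fun i hi => by
      simp only [colNbrs, List.mem_filter, decide_eq_true_eq] at hi
      exact hi.2.1) x1 t1

lemma step_of_isolated {K : Matrix (Fin n) (Fin n) ℝ} {k : Fin n} (hr : rowNbrs K k = [])
    (hc : colNbrs K k = []) (ε : ℝ) (s : State n) : step K ε k s = pure s := by
  rw [step, hr, hc]
  rfl

lemma step_of_not_isolated {K : Matrix (Fin n) (Fin n) ℝ} {k : Fin n}
    (h : ¬ (rowNbrs K k = [] ∧ colNbrs K k = [])) (ε : ℝ) (s : State n) :
    let y := s.x k + (Real.log (s.c k) - Real.log (s.r k)) / 2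
    let s₁ := rowPass K k y s
    let s₂ := colPass K k y s₁.val
    step K ε k s = ⟨(test ε { s₂.val with x := Function.update s₂.val.x k y }).val,
      1 + (1 + (1 + (1 + (1 + (s₁.ops + (s₂.ops + 2))))))⟩ := by
  rw [step, if_neg (by simpa only [Bool.and_eq_true, List.isEmpty_iff] using h)]
  rfl

lemma step_ops_le (K : Matrix (Fin n) (Fin n) ℝ) (ε : ℝ) (k : Fin n) (s : State n) :
    (step K ε k s).ops ≤ 29 * nbrCount K k := by
  by_cases h : rowNbrs K k = [] ∧ colNbrs K k = []
  · rw [step_of_isolated h.1 h.2]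
    exact Nat.zero_le _
  · rw [step_of_not_isolated h]
    simp only [rowPass_ops, colPass_ops]
    have hpos : nbrCount K k ≠ 0 := by
      simpa only [nbrCount, ne_eq, Nat.add_eq_zero_iff, List.length_eq_zero_iff] using h
    simp only [nbrCount] at hpos ⊢
    omega

lemma step_correct {K : Matrix (Fin n) (Fin n) ℝ} (hK : ∀ i j, 0 ≤ K i j) {ε : ℝ} (hε : 0 < ε)
    (k : Fin n) {s : State n} (hs : Correct K ε s) :
    (step K ε k s).val.x = update K s.x k ∧ Correct K ε (step K ε k s).val := by
  by_cases h : rowNbrs K k = [] ∧ colNbrs K k = []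
  · rw [step_of_isolated h.1 h.2]
    exact ⟨(update_eq_self h.1 h.2 s.x).symm, hs⟩
  · rw [step_of_not_isolated h]
    have hy : Function.update s.x k (s.x k + (Real.log (s.c k) - Real.log (s.r k)) / 2) =
        update K s.x k := by
      rw [update, hs.tracks.r, hs.tracks.c]
    generalize s.x k + (Real.log (s.c k) - Real.log (s.r k)) / 2 = y at hy ⊢
    obtain ⟨hx, ht⟩ := passes_spec k y hs.tracks rfl
    generalize (colPass K k y _).val = s₂ at hx ht ⊢
    constructor
    · change Function.update s₂.x k y = update K s.x k
      rw [hx, hy]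
    · rw [← hx] at ht
      exact Tracks.test hK hε ⟨ht.r, ht.c, ht.imb, ht.tot⟩

/-! ### The main loop -/

lemma loop_succ_of_done {K : Matrix (Fin n) (Fin n) ℝ} {ε : ℝ} {k : ℕ → Fin n} {t : ℕ}
    (h : (loop K ε k t).val.done = true) :
    (loop K ε k (t + 1)).val = (loop K ε k t).val ∧
      (loop K ε k (t + 1)).ops = (loop K ε k t).ops := by
  rw [loop, Counted.bind_val, Counted.bind_ops, if_pos h]
  exact ⟨rfl, rfl⟩

lemma loop_succ_of_not_done {K : Matrix (Fin n) (Fin n) ℝ} {ε : ℝ} {k : ℕ → Fin n} {t : ℕ}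
    (h : ¬ (loop K ε k t).val.done = true) :
    (loop K ε k (t + 1)).val = (step K ε (k t) (loop K ε k t).val).val ∧
      (loop K ε k (t + 1)).ops =
        (loop K ε k t).ops + (step K ε (k t) (loop K ε k t).val).ops := by
  rw [loop, Counted.bind_val, Counted.bind_ops, if_neg h]
  exact ⟨rfl, rfl⟩

lemma loop_correct {K : Matrix (Fin n) (Fin n) ℝ} (hK : ∀ i j, 0 ≤ K i j) {ε : ℝ} (hε : 0 < ε)
    (k : ℕ → Fin n) {t : ℕ} (ht : ∀ u < t, ¬ SolvesABAL K ε (iterate K k u)) :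
    (loop K ε k t).val.x = iterate K k t ∧ Correct K ε (loop K ε k t).val := by
  induction t with
  | zero => exact init_correct hK hε
  | succ t ih =>
    obtain ⟨hx, hc⟩ := ih fun u hu => ht u (by omega)
    have hnd : ¬ (loop K ε k t).val.done = true := by
      rw [hc.done_iff, hx]
      exact ht t (by omega)
    rw [(loop_succ_of_not_done hnd).1, iterate, ← hx]
    exact step_correct hK hε _ hc

lemma loop_ops_le (K : Matrix (Fin n) (Fin n) ℝ) (ε : ℝ) (k : ℕ → Fin n) (t : ℕ) :
    (loop K ε k t).ops ≤ 29 * ∑ u ∈ Finset.range t, nbrCount K (k u) := by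
  induction t with
  | zero => exact Nat.zero_le _
  | succ t ih =>
    rw [Finset.sum_range_succ, mul_add]
    by_cases h : (loop K ε k t).val.done = true
    · rw [(loop_succ_of_done h).2]
      omega
    · rw [(loop_succ_of_not_done h).2]
      exact add_le_add ih (step_ops_le K ε _ _)

lemma loopOps_le_of_done {K : Matrix (Fin n) (Fin n) ℝ} {ε : ℝ} {k : ℕ → Fin n} {τ : ℕ}
    (h : (loop K ε k τ).val.done = true) :
    loopOps K ε k ≤ (29 * ∑ u ∈ Finset.range τ, nbrCount K (k u) : ℕ) := by
  have hconst : ∀ m, (loop K ε k (τ + m)).val = (loop K ε k τ).val ∧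
      (loop K ε k (τ + m)).ops = (loop K ε k τ).ops := by
    intro m
    induction m with
    | zero => exact ⟨rfl, rfl⟩
    | succ m ih =>
      have hd : (loop K ε k (τ + m)).val.done = true := by rw [ih.1, h]
      exact ⟨(loop_succ_of_done hd).1.trans ih.1, (loop_succ_of_done hd).2.trans ih.2⟩
  refine iSup_le fun N => ?_
  rw [Nat.cast_le]
  rcases le_total N τ with hN | hN
  · exact (loop_ops_le K ε k N).trans (Nat.mul_le_mul_left _
      (Finset.sum_le_sum_of_subset (Finset.range_mono hN)))
  · obtain ⟨m, rfl⟩ := Nat.exists_eq_add_of_le hN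
    rw [(hconst m).2]
    exact loop_ops_le K ε k τ

/-! ### Cyclic orders -/

lemma cyclicCoord_add [NeZero n] (σ : ℕ → Equiv.Perm (Fin n)) (j : ℕ) {t : ℕ} (ht : t < n) :
    cyclicCoord σ (j * n + t) = σ j (Fin.ofNat n t) := by
  have h1 : (j * n + t) / n = j := by
    rw [mul_comm, Nat.mul_add_div (NeZero.pos n), Nat.div_eq_of_lt ht, add_zero]
  have h2 : Fin.ofNat n (j * n + t) = Fin.ofNat n t := by
    ext
    simp [Fin.ofNat, mul_comm j n]
  rw [cyclicCoord, h1, h2]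

lemma injOn_cyclicCoord_add [NeZero n] (σ : ℕ → Equiv.Perm (Fin n)) (j : ℕ) :
    Set.InjOn (fun t => cyclicCoord σ (j * n + t)) (Finset.range n) := by
  intro s hs t ht hst
  have hs' : s < n := by simpa using hs
  have ht' : t < n := by simpa using ht
  simp only [cyclicCoord_add σ j hs', cyclicCoord_add σ j ht'] at hst
  have h := congrArg Fin.val ((σ j).injective hst)
  simpa [Fin.ofNat, Nat.mod_eq_of_lt hs', Nat.mod_eq_of_lt ht'] using h

lemma sum_nbrCount_cyclicCoord [NeZero n] (K : Matrix (Fin n) (Fin n) ℝ)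
    (σ : ℕ → Equiv.Perm (Fin n)) (J : ℕ) :
    ∑ u ∈ Finset.range (J * n), nbrCount K (cyclicCoord σ u) ≤ J * (2 * nnz K) := by
  induction J with
  | zero => simp
  | succ J ih =>
    rw [Nat.succ_mul, Finset.sum_range_add, Nat.succ_mul]
    refine add_le_add ih ?_
    rw [← Finset.sum_image (f := nbrCount K) (injOn_cyclicCoord_add σ J)]
    exact (Finset.sum_le_sum_of_subset (Finset.subset_univ _)).trans (sum_nbrCount_le K)

/-- For every choice of the orders of the cycles, the loop stops at the first `ε`-balanced iterate
within `22272 (m / ε) (1/ε ∧ d) log κ` arithmetic operations. -/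
theorem cyclic_loop_bound [NeZero n] {K : Matrix (Fin n) (Fin n) ℝ} (hK : ∀ i j, 0 ≤ K i j)
    (hb : IsBalanceable K) {ε : ℝ} (hε : 0 < ε) (σ : ℕ → Equiv.Perm (Fin n)) :
    (∃ τ : ℕ,
      (loop K ε (cyclicCoord σ) τ).val.done = true ∧
      (loop K ε (cyclicCoord σ) τ).val.x = iterate K (cyclicCoord σ) τ ∧
      SolvesABAL K ε (iterate K (cyclicCoord σ) τ) ∧
      ∀ t < τ, ¬ SolvesABAL K ε (iterate K (cyclicCoord σ) t)) ∧
    (loopOps K ε (cyclicCoord σ) : ℝ≥0∞) ≤ ENNReal.ofReal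
      (22272 * (nnz K / ε * invMin ε (diam K) * Real.log (condNumber K))) := by
  classical
  set k := cyclicCoord σ with hk
  set B := 384 * (invMin ε (diam K) * Real.log (condNumber K)) / ε with hB
  have hcyc : ∀ j, imbalance (scaling K (iterate K k (j * n))) ^ 2 ≤
      48 * (total (scaling K (iterate K k (j * n))) -
        total (scaling K (iterate K k ((j + 1) * n)))) *
        total (scaling K (iterate K k (j * n))) := by
    intro j
    rw [Nat.succ_mul]
    exact cycle_progress hK hb (injOn_cyclicCoord_add σ j)
      (y := fun t => iterate K k (j * n + t)) fun t _ => rfl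
  have hcount : ∀ N : ℕ, (∀ j < N, ¬ SolvesABAL K ε (iterate K k (j * n))) → (N : ℝ) ≤ B :=
    fun N hN => cycles_le hK hb hε (z := fun j => iterate K k (j * n))
      (by simp only [zero_mul]; rfl) hcyc hN
  have hex : ∃ j, SolvesABAL K ε (iterate K k (j * n)) := by
    by_contra! h
    obtain ⟨N, hN⟩ := exists_nat_gt B
    exact (hcount N fun j _ => h j).not_gt hN
  have hJ : (Nat.find hex : ℝ) ≤ B := hcount _ fun j hj => Nat.find_min hex hj
  have hex' : ∃ t, SolvesABAL K ε (iterate K k t) := ⟨_, Nat.find_spec hex⟩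
  have hτJ : Nat.find hex' ≤ Nat.find hex * n := Nat.find_min' hex' (Nat.find_spec hex)
  have hmin : ∀ t < Nat.find hex', ¬ SolvesABAL K ε (iterate K k t) :=
    fun t ht => Nat.find_min hex' ht
  obtain ⟨hx, hc⟩ := loop_correct hK hε k hmin
  have hdone : (loop K ε k (Nat.find hex')).val.done = true := by
    rw [hc.done_iff, hx]
    exact Nat.find_spec hex'
  refine ⟨⟨Nat.find hex', hdone, hx, Nat.find_spec hex', hmin⟩, ?_⟩
  have hops : loopOps K ε k ≤ (58 * nnz K * Nat.find hex : ℕ) := by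
    refine (loopOps_le_of_done hdone).trans ?_
    rw [Nat.cast_le]
    have h1 := Finset.sum_le_sum_of_subset (f := fun u => nbrCount K (k u))
      (Finset.range_mono hτJ)
    have h2 := sum_nbrCount_cyclicCoord K σ (Nat.find hex)
    calc 29 * ∑ u ∈ Finset.range (Nat.find hex'), nbrCount K (k u)
        ≤ 29 * (Nat.find hex * (2 * nnz K)) := Nat.mul_le_mul_left _ (h1.trans h2)
      _ = 58 * nnz K * Nat.find hex := by ring
  calc (loopOps K ε k : ℝ≥0∞) ≤ ((58 * nnz K * Nat.find hex : ℕ) : ℝ≥0∞) := by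
        have := ENat.toENNReal_le.2 hops
        simpa using this
    _ = ENNReal.ofReal ((58 * nnz K * Nat.find hex : ℕ) : ℝ) := (ENNReal.ofReal_natCast _).symm
    _ ≤ _ := by
        refine ENNReal.ofReal_le_ofReal ?_
        push_cast
        calc (58 : ℝ) * nnz K * Nat.find hex ≤ 58 * nnz K * B :=
              mul_le_mul_of_nonneg_left hJ (by positivity)
          _ = _ := by rw [hB]; ring

lemma nnz_mul_invMin_le_runtimeBound [NeZero n] {K : Matrix (Fin n) (Fin n) ℝ}
    (hK : ∀ i j, 0 ≤ K i j) {ε : ℝ} (hε : 0 < ε) :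
    nnz K / ε * invMin ε (diam K) * Real.log (condNumber K) ≤ runtimeBound K ε := by
  have h1 : (1 : ℝ) ≤ √n := Real.one_le_sqrt.2 (by exact_mod_cast NeZero.one_le)
  rw [runtimeBound]
  gcongr
  · exact log_condNumber_nonneg hK
  · exact invMin_nonneg _ _
  · exact le_mul_of_one_le_right (Nat.cast_nonneg _) h1

end Osborne

end

theorem theorem6p1 :
    ∃ C : ℝ, 0 < C ∧
      ∀ (n : ℕ) [NeZero n] (K : Matrix (Fin n) (Fin n) ℝ) (ε : ℝ)
        (Ω : Type*) [MeasurableSpace Ω] (P : Measure Ω) [IsProbabilityMeasure P]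
        (σ : ℕ → Ω → Equiv.Perm (Fin n)),
        (∀ i j, 0 ≤ K i j) → Osborne.IsBalanceable K → 0 < ε → Osborne.IsRandomOrder P σ →
        -- preprocessing takes `O(m + n)` arithmetic operations
        ((Osborne.init K ε).ops : ℝ) ≤ C * (Osborne.nnz K + n) ∧
        -- almost surely the loop stops, with output the first iterate that is `ε`-balanced
        (∀ᵐ ω ∂P, ∃ τ : ℕ,
          let k := Osborne.cyclicCoord (fun j => σ j ω)
          (Osborne.loop K ε k τ).val.done = true ∧
          (Osborne.loop K ε k τ).val.x = Osborne.iterate K k τ ∧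
          Osborne.SolvesABAL K ε (Osborne.iterate K k τ) ∧
          ∀ t < τ, ¬ Osborne.SolvesABAL K ε (Osborne.iterate K k t)) ∧
        -- expectation guarantee
        (∫⁻ ω, (Osborne.loopOps K ε (Osborne.cyclicCoord (fun j => σ j ω)) : ℝ≥0∞) ∂P
          ≤ ENNReal.ofReal (C * Osborne.runtimeBound K ε)) ∧
        -- high probability guarantee
        (∀ δ : ℝ, 0 < δ → δ ≤ Real.exp (-1) →
          ENNReal.ofReal (1 - δ) ≤
            P {ω | (Osborne.loopOps K ε (Osborne.cyclicCoord (fun j => σ j ω)) : ℝ≥0∞)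
              ≤ ENNReal.ofReal (C * (Osborne.runtimeBound K ε * Real.log (1 / δ)))}) := by
  refine ⟨22272, by norm_num, ?_⟩
  intro n _ K ε Ω _ P _ σ hK hb hε _
  have hT : ∀ ω, (Osborne.loopOps K ε (Osborne.cyclicCoord (fun j => σ j ω)) : ℝ≥0∞) ≤
      ENNReal.ofReal (22272 * Osborne.runtimeBound K ε) := fun ω =>
    (Osborne.cyclic_loop_bound hK hb hε fun j => σ j ω).2.trans (ENNReal.ofReal_le_ofReal
      (mul_le_mul_of_nonneg_left (Osborne.nnz_mul_invMin_le_runtimeBound hK hε) (by norm_num)))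
  refine ⟨?_, ?_, ?_, ?_⟩
  · have hn : (1 : ℝ) ≤ n := by exact_mod_cast NeZero.one_le
    have hm : (0 : ℝ) ≤ Osborne.nnz K := Nat.cast_nonneg _
    rw [Osborne.init_ops]
    push_cast
    linarith
  · exact Filter.Eventually.of_forall fun ω =>
      (Osborne.cyclic_loop_bound hK hb hε fun j => σ j ω).1
  · refine (lintegral_mono hT).trans ?_
    rw [lintegral_const, measure_univ, mul_one]
  · intro δ hδ hδe
    have hlog : 1 ≤ Real.log (1 / δ) := by
      rw [one_div, Real.log_inv]
      have := Real.log_le_log hδ hδe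
      rw [Real.log_exp] at this
      linarith
    have hR : 0 ≤ Osborne.runtimeBound K ε := by
      have := Osborne.log_condNumber_nonneg hK
      have := Osborne.invMin_nonneg ε (Osborne.diam K)
      rw [Osborne.runtimeBound]
      positivity
    have huniv : {ω | (Osborne.loopOps K ε (Osborne.cyclicCoord (fun j => σ j ω)) : ℝ≥0∞)
        ≤ ENNReal.ofReal (22272 * (Osborne.runtimeBound K ε * Real.log (1 / δ)))} = Set.univ :=
      Set.eq_univ_of_forall fun ω => (hT ω).trans (ENNReal.ofReal_le_ofReal
        (mul_le_mul_of_nonneg_left (le_mul_of_one_le_right hR hlog) (by norm_num)))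
    rw [huniv, measure_univ]
    exact ENNReal.ofReal_le_one.2 (by linarith)
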